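/- Let $\Lambda$ be Lebesgue measure and let $\nu$ be a nonzero finite Borel measure on $(0,1)$, regarded as a Borel measure on $\mathbb{R}$ with topological support $\operatorname{supp}\nu\subseteq[0,1]$. Let $H^1_0(0,1)$ be the space of functions $f:[0,1]\to\mathbb{R}$ with $f(0)=f(1)=0$ for which there is $\nabla f\in L^2_\Lambda(0,1)$ with $f(x)=f(0)+\int_0^x\nabla f\,d\Lambda$ for all $x\in[0,1]$. Let $\operatorname{dom}(\mathcal{E}_\nu)$ be the set of $f\in H^1_0(0,1)$ that are affine on every connected component of $[0,1]\setminus\operatorname{supp}\nu$, and put $\mathcal{E}_\nu(f,g)=\int_{(0,1)}\nabla f\,\nabla g\,d\Lambda$. A function $f\in\operatorname{dom}(\mathcal{E}_\nu)\setminus\{0\}$ is an eigenfunction with eigenvalue $\lambda\in\mathbb{R}$ if $\mathcal{E}_\nu(f,g)=\lambda\int fg\,d\nu$ for all $g\in\operatorname{dom}(\mathcal{E}_\nu)$. Let $N_\nu(x)$ be the number of eigenvalues not exceeding $x$, counted with multiplicity (the dimension of the span of all eigenfunctions with eigenvalue at most $x$), and define the lower and upper spectral dimensions $$\underline{s}_\nu=\liminf_{x\to\infty}\frac{\log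 N_\nu(x)}{\log x},\qquad \overline{s}_\nu=\limsup_{x\to\infty}\frac{\log N_\nu(x)}{\log x}.$$ For $q\in\mathbb{R}$ let $\beta_\nu(q)=\limsup_{n\to\infty}\frac{1}{\log 2^n}\log\sum_{C}\nu(C)^q$, where $C$ runs over the dyadic intervals $(k2^{-n},(k+1)2^{-n}]$, $0\le k<2^n$, with $\nu(C)>0$. Let $\overline{\delta}_\nu=\lim_{t\nearrow1}\beta_\nu(t)/(1-t)$ and $\underline{\delta}_\nu=\lim_{t\searrow1}\beta_\nu(t)/(1-t)$ be the negated left and right derivatives of $\beta_\nu$ at $1$ (note that $\beta_\nu(1)=0$). Let $\delta^*_\nu=\limsup_{\varepsilon\downarrow0}\frac{\log N_\varepsilon}{-\log\varepsilon}$ be the upper Minkowski dimension of $\operatorname{supp}\nu$, where $N_\varepsilon$ is the least number of closed $\varepsilon$-balls centred in $\operatorname{supp}\nu$ that cover $\operatorname{supp}\nu$. Then the limits defining $\overline{\delta}_\nu$ and $\underline{\delta}_\nu$ exist, all five quantities are finite real numbers, and $$\frac{\underline{\delta}_\nu}{1+\overline{\delta}_\nu}\le\underline{s}_\nu\le\overline{s}_\nu\le\frac{\delta^*_\nu}{1+\delta^*_\nu}\le\frac12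 .$$ Moreover, $\overline{s}_\nu=\frac{\delta^*_\nu}{1+\delta^*_\nu}$ if and only if $\overline{\delta}_\nu=\delta^*_\nu$. -/

import Mathlib

open MeasureTheory Filter Set Topology
open scoped ENNReal NNReal

namespace KreinFeller

noncomputable section

/-- `g` is a weak gradient of `f` on `(0,1)`: `g` is square integrable with respect to Lebesgue
measure and `f x = f 0 + ∫₀ˣ g` for every `x ∈ [0,1]`. -/
def IsWeakGradient (f g : ℝ → ℝ) : Prop :=
  MemLp g 2 (volume.restrict (Ioo (0 : ℝ) 1)) ∧
    ∀ x ∈ Icc (0 : ℝ) 1, f x = f 0 + ∫ t in (0 : ℝ)..x, g t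

/-- The Sobolev space `H¹₀(0,1)`. A function on `[0,1]` that vanishes at both endpoints is
identified with its extension by zero to the real line. -/
def H10 : Set (ℝ → ℝ) :=
  {f | (∃ g, IsWeakGradient f g) ∧ ∀ x, x ∉ Ioo (0 : ℝ) 1 → f x = 0}

open Classical in
/-- The weak gradient `∇f` of `f` (unique up to Lebesgue null sets when it exists). -/
def weakGradient (f : ℝ → ℝ) : ℝ → ℝ :=
  if h : ∃ g, IsWeakGradient f g then h.choose else 0

/-- `f` is affine on every connected component of `[0,1] \ supp ν`. -/
def IsAffineOffSupport (ν : Measure ℝ) (f : ℝ → ℝ) : Prop :=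
  ∀ x ∈ Icc (0 : ℝ) 1 \ ν.support, ∃ m c : ℝ,
    ∀ y ∈ connectedComponentIn (Icc (0 : ℝ) 1 \ ν.support) x, f y = m * y + c

/-- The (Dirichlet) domain of the form: functions in `H¹₀(0,1)` that are affine on the components
of `[0,1] \ supp ν`. -/
def formDomain (ν : Measure ℝ) : Set (ℝ → ℝ) :=
  {f | f ∈ H10 ∧ IsAffineOffSupport ν f}

/-- The form `ℰ(f,g) = ∫ ∇f ∇g dΛ` over `(0,1)`. -/
def energy (f g : ℝ → ℝ) : ℝ :=
  ∫ x in Ioo (0 : ℝ) 1, weakGradient f x * weakGradient g x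

/-- `f` is an eigenfunction of the form `ℰ_ν` with eigenvalue `l`. -/
def IsEigenfunction (ν : Measure ℝ) (l : ℝ) (f : ℝ → ℝ) : Prop :=
  f ∈ formDomain ν ∧ f ≠ 0 ∧
    ∀ g ∈ formDomain ν, energy f g = l * ∫ x, f x * g x ∂ν

/-- The eigenvalue counting function: the number of eigenvalues not exceeding `x`, counted with
multiplicity, that is, the dimension of the space spanned by all eigenfunctions with eigenvalue at
most `x` (eigenfunctions for different eigenvalues are linearly independent). -/
def eigenvalueCount (ν : Measure ℝ) (x : ℝ) : ℕ∞ :=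
  Cardinal.toENat
    (Module.rank ℝ (Submodule.span ℝ {f : ℝ → ℝ | ∃ l ≤ x, IsEigenfunction ν l f}))

/-- The quotient `log N_ν(x) / log x`, as an extended real number. -/
def spectralQuotient (ν : Measure ℝ) (x : ℝ) : EReal :=
  ENNReal.log (eigenvalueCount ν x : ℝ≥0∞) / ((Real.log x : ℝ) : EReal)

/-- The lower spectral dimension. -/
def lowerSpectralDim (ν : Measure ℝ) : EReal :=
  liminf (spectralQuotient ν) atTop

/-- The upper spectral dimension. -/
def upperSpectralDim (ν : Measure ℝ) : EReal :=
  limsup (spectralQuotient ν) atTop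

/-- The dyadic interval `(k 2⁻ⁿ, (k+1) 2⁻ⁿ]`. -/
def dyadicCell (n k : ℕ) : Set ℝ :=
  Ioc ((k : ℝ) / 2 ^ n) (((k : ℝ) + 1) / 2 ^ n)

open Classical in
/-- `β_n(q) = (log 2ⁿ)⁻¹ log ∑ ν(C)^q`, the sum over the dyadic intervals `C ⊆ (0,1]` of
length `2⁻ⁿ` with `ν(C) > 0`. -/
def lqSpectrumAt (ν : Measure ℝ) (n : ℕ) (q : ℝ) : ℝ :=
  1 / Real.log ((2 : ℝ) ^ n) *
    Real.log (∑ k ∈ (Finset.range (2 ^ n)).filter (fun k => 0 < ν (dyadicCell n k)),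
      (ν (dyadicCell n k)).toReal ^ q)

/-- The `L^q`-spectrum `β_ν(q) = limsup β_n(q)`, as an extended real number. -/
def lqSpectrum (ν : Measure ℝ) (q : ℝ) : EReal :=
  limsup (fun n : ℕ => ((lqSpectrumAt ν n q : ℝ) : EReal)) atTop

/-- The upper Minkowski (box-counting) dimension `limsup_{ε ↓ 0} log N_ε(A) / (- log ε)`, where
`N_ε(A)` is the least number of closed `ε`-balls with centres in `A` that cover `A`. -/
def upperMinkowskiDim (A : Set ℝ) : EReal :=
  limsup (fun ε : ℝ =>
    ENNReal.log (Metric.coveringNumber ε.toNNReal A : ℝ≥0∞) / ((-Real.log ε : ℝ) : EReal))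
    (𝓝[>] (0 : ℝ))

end

end KreinFeller

/-! Functions in $H^1_0(0,1)$ are the primitives of mean-zero functions in $L^2(0,1)$, and the
energy becomes the $L^2$ inner product. In this picture $\int fg\,d\nu$ is the form of a compact
positive operator $T$, an integral of rank-one operators built from evaluation vectors. Its
eigenvectors for $\mu>0$ are the gradients of eigenfunctions with eigenvalue $1/\mu$. Everything
then reduces to comparing $N_\nu(x)$ with numbers of heavy dyadic cells.

From above (`eigenvalueCount_le_card`): a function vanishing at 0 and at the midpoints of all cells
with $\nu(C)\Lambda(C)>t$ satisfies $\int f^2\,d\nu\le t\,\mathcal E(f,f)$, by a Poincaré inequality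
on the remaining cells. In the span counted by $N_\nu(x)$ this forces $f=0$ once $xt<1$, so
$N_\nu(x)$ is at most the number of such cells. Chebyshev's inequality bounds this number by $Bx^q$
whenever $\beta(q)<q$ (`exists_eigenvalueNum_le`).

From below (`card_heavyCells_le`): trapezoids over cells of level $n$ and mass at least $m$ have
Rayleigh quotient at most $2\cdot2^n/m$, and every third one has disjoint support. This has two
uses. Most of the mass sits in cells of mass between $2^{-na}$ and $2^{-nb}$ for $a>\overline\delta$
and $b<\underline\delta$, which yields $b/(1+a)\le\underline s$. Conversely, $N_\nu(x)\le x^s$ for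
large $x$ forces $\beta(q)\le s$ for $q>s$ (`hasGrowth_of_eigenvalueNum_le`).

The rest is convexity. We have $\beta(1)=0$ and $\beta(0)=\delta^*$, and the chord $\delta^*(1-q)$
meets the diagonal at $\delta^*/(1+\delta^*)$. If $\overline\delta=\delta^*$, then $\beta$ is the
chord on $[0,1]$ and the bound is attained. Otherwise $\beta$ lies strictly below the chord at that
point, and the inequality is strict. -/

namespace KreinFeller

/-! ### Variational counting for compact symmetric operators. -/

section CompactSymmetric

variable {H : Type*} [NormedAddCommGroup H] [InnerProductSpace ℝ H] [CompleteSpace H]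

/-- If all eigenvalues of a compact symmetric operator are at most `c`, then so are its Rayleigh
quotients. -/
theorem inner_apply_self_le_of_eigenvalues_le {T : H →L[ℝ] H} (hT : IsCompactOperator T)
    (hs : (T : H →ₗ[ℝ] H).IsSymmetric) {c : ℝ}
    (hc : ∀ μ : ℝ, Module.End.HasEigenvalue (T : Module.End ℝ H) μ → μ ≤ c) (v : H) :
    inner ℝ (T v) v ≤ c * ‖v‖ ^ 2 := by
  set E : Submodule ℝ H := ⨆ μ, Module.End.eigenspace (T : Module.End ℝ H) μ with hE
  have hdense : Dense (E : Set H) := by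
    rw [Submodule.dense_iff_topologicalClosure_eq_top,
      Submodule.topologicalClosure_eq_top_iff]
    exact ContinuousLinearMap.orthogonalComplement_iSup_eigenspaces_eq_bot hT hs
  have hclosed : IsClosed {v : H | inner ℝ (T v) v ≤ c * ‖v‖ ^ 2} :=
    isClosed_le (T.continuous.inner continuous_id) (by fun_prop)
  have hsub : (E : Set H) ⊆ {v : H | inner ℝ (T v) v ≤ c * ‖v‖ ^ 2} := by
    intro w hw
    obtain ⟨f, hf, rfl⟩ := (Submodule.mem_iSup_iff_exists_finsupp _ _).1 hw
    have hfam := hs.orthogonalFamily_eigenspaces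
    have horth : ∀ i j, i ≠ j → inner ℝ (f i) (f j) = 0 := fun i j hij =>
      hfam hij ⟨f i, hf i⟩ ⟨f j, hf j⟩
    have hTf : ∀ i, T (f i) = i • f i := fun i => Module.End.mem_eigenspace_iff.1 (hf i)
    have h1 : inner ℝ (T (f.sum fun _ x => x)) (f.sum fun _ x => x)
        = ∑ i ∈ f.support, i * ‖f i‖ ^ 2 := by
      rw [Finsupp.sum, map_sum, sum_inner]
      refine Finset.sum_congr rfl fun i hi => ?_
      rw [inner_sum, Finset.sum_eq_single i]
      · rw [hTf, inner_smul_left, real_inner_self_eq_norm_sq]; simp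
      · intro j _ hji
        rw [hTf, inner_smul_left, horth i j (Ne.symm hji), mul_zero]
      · intro h; exact absurd hi h
    have h2 : ‖f.sum fun _ x => x‖ ^ 2 = ∑ i ∈ f.support, ‖f i‖ ^ 2 := by
      rw [← real_inner_self_eq_norm_sq, Finsupp.sum, sum_inner]
      refine Finset.sum_congr rfl fun i hi => ?_
      rw [inner_sum, Finset.sum_eq_single i]
      · rw [real_inner_self_eq_norm_sq]
      · intro j _ hji
        exact horth i j (Ne.symm hji)
      · intro h; exact absurd hi h
    rw [mem_ofPred_eq, h1, h2, Finset.mul_sum]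
    refine Finset.sum_le_sum fun i hi => ?_
    refine mul_le_mul_of_nonneg_right (hc i ?_) (sq_nonneg _)
    exact Module.End.hasEigenvalue_of_hasEigenvector ⟨hf i, Finsupp.mem_support_iff.1 hi⟩
  exact hclosed.closure_subset_iff.2 hsub (hdense v)

/-- The span of the eigenvectors of `T` for eigenvalues at least `c`. -/
def upperEigenspan (T : H →L[ℝ] H) (c : ℝ) : Submodule ℝ H :=
  Submodule.span ℝ {v | ∃ μ, c ≤ μ ∧ T v = μ • v}

/-- By symmetry the orthogonal complement is invariant, and $T$ restricted to it is again compact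
and symmetric. An eigenvector there with eigenvalue above `c` would lie in the span as well as in
its complement, so the restriction has no such eigenvalue. -/
theorem inner_apply_self_le_of_mem_orthogonal {T : H →L[ℝ] H} (hT : IsCompactOperator T)
    (hs : (T : H →ₗ[ℝ] H).IsSymmetric) {c : ℝ} {v : H} (hv : v ∈ (upperEigenspan T c)ᗮ) :
    inner ℝ (T v) v ≤ c * ‖v‖ ^ 2 := by
  have hinv : ∀ w ∈ (upperEigenspan T c)ᗮ, (T : H →ₗ[ℝ] H) w ∈ (upperEigenspan T c)ᗮ := by
    intro w hw
    rw [Submodule.mem_orthogonal] at hw ⊢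
    intro u hu
    have hTu : (T : H →ₗ[ℝ] H) u ∈ upperEigenspan T c := by
      refine Submodule.span_induction (p := fun u _ => (T : H →ₗ[ℝ] H) u ∈ upperEigenspan T c)
        ?_ ?_ ?_ ?_ hu
      · rintro x ⟨μ, hμ, hx⟩
        rw [ContinuousLinearMap.coe_coe, hx]
        exact Submodule.smul_mem _ _ (Submodule.subset_span ⟨μ, hμ, hx⟩)
      · simp
      · intro x y _ _ hx hy; rw [map_add]; exact Submodule.add_mem _ hx hy
      · intro a x _ hx; rw [map_smul]; exact Submodule.smul_mem _ _ hx
    rw [← hs u w]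
    exact hw _ hTu
  let S : (upperEigenspan T c)ᗮ →L[ℝ] (upperEigenspan T c)ᗮ := T.restrict hinv
  have hS : IsCompactOperator S := hT.restrict' hinv
  have hSs : (S : (upperEigenspan T c)ᗮ →ₗ[ℝ] (upperEigenspan T c)ᗮ).IsSymmetric :=
    hs.restrict_invariant hinv
  have := inner_apply_self_le_of_eigenvalues_le hS hSs (c := c) ?_ ⟨v, hv⟩
  · exact this
  · intro μ hμ
    by_contra! hcμ
    obtain ⟨w, hw⟩ := hμ.exists_hasEigenvector
    have hw1 : S w = μ • w := hw.apply_eq_smul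
    have hw2 : T (w : H) = μ • (w : H) := congrArg Subtype.val hw1
    have hmem : (w : H) ∈ upperEigenspan T c := Submodule.subset_span ⟨μ, hcμ.le, hw2⟩
    have h0 : (w : H) = 0 := by
      have := (Submodule.mem_orthogonal _ _).1 w.2 _ hmem
      exact inner_self_eq_zero.1 this
    exact hw.2 (Subtype.ext h0)

/-- An orthogonal family which is also orthogonal for the form of `T`, with Rayleigh quotients
larger than `c`, has at most as many members as `T` has eigenvalues that are at least `c`. -/
theorem card_le_rank_upperEigenspan {T : H →L[ℝ] H} (hT : IsCompactOperator T)
    (hs : (T : H →ₗ[ℝ] H).IsSymmetric) {c : ℝ} {ι : Type*} [Fintype ι] {v : ι → H}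
    (horth : ∀ i j, i ≠ j → inner ℝ (v i) (v j) = 0)
    (hTorth : ∀ i j, i ≠ j → inner ℝ (T (v i)) (v j) = 0)
    (hlt : ∀ i, c * ‖v i‖ ^ 2 < inner ℝ (T (v i)) (v i)) :
    (Fintype.card ι : Cardinal) ≤ Module.rank ℝ (upperEigenspan T c) := by
  by_contra! hcard
  set W := upperEigenspan T c
  have : FiniteDimensional ℝ W :=
    Module.rank_lt_aleph0_iff.1 (hcard.trans (Cardinal.natCast_lt_aleph0))
  have hfin : Module.finrank ℝ W < Fintype.card ι := by
    rw [← Module.finrank_eq_rank] at hcard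
    exact_mod_cast hcard
  let L : (ι → ℝ) →ₗ[ℝ] W :=
    (W.orthogonalProjectionOnto : H →L[ℝ] W).toLinearMap ∘ₗ Fintype.linearCombination ℝ v
  -- With too few eigenvectors some nontrivial combination of the `v i` is orthogonal to `W`. Double
  -- orthogonality makes its Rayleigh quotient exceed `c`, contradicting the previous lemma.
  have hker : LinearMap.ker L ≠ ⊥ := LinearMap.ker_ne_bot_of_finrank_lt (by simpa using hfin)
  obtain ⟨a, ha, ha0⟩ := Submodule.exists_mem_ne_zero_of_ne_bot hker
  have hmem : (∑ i, a i • v i) ∈ Wᗮ := by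
    have h1 : L a = 0 := ha
    have h2 : W.orthogonalProjectionOnto (∑ i, a i • v i) = 0 := by
      simpa [L, Fintype.linearCombination_apply] using h1
    exact Submodule.orthogonalProjectionOnto_eq_zero_iff.1 h2
  have hle := inner_apply_self_le_of_mem_orthogonal hT hs hmem
  have h1 : inner ℝ (T (∑ i, a i • v i)) (∑ i, a i • v i)
      = ∑ i, a i ^ 2 * inner ℝ (T (v i)) (v i) := by
    rw [map_sum, sum_inner]
    refine Finset.sum_congr rfl fun i _ => ?_
    rw [inner_sum, Finset.sum_eq_single i]
    · rw [map_smul, inner_smul_left, inner_smul_right]; simp; ring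
    · intro j _ hji
      rw [map_smul, inner_smul_left, inner_smul_right, hTorth i j hji.symm]; simp
    · simp
  have h2 : ‖∑ i, a i • v i‖ ^ 2 = ∑ i, a i ^ 2 * ‖v i‖ ^ 2 := by
    rw [← real_inner_self_eq_norm_sq, sum_inner]
    refine Finset.sum_congr rfl fun i _ => ?_
    rw [inner_sum, Finset.sum_eq_single i]
    · rw [inner_smul_left, inner_smul_right, real_inner_self_eq_norm_sq]; simp; ring
    · intro j _ hji
      rw [inner_smul_left, inner_smul_right, horth i j hji.symm]; simp
    · simp
  rw [h1, h2, Finset.mul_sum] at hle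
  refine absurd hle (not_le.2 ?_)
  obtain ⟨i, hi⟩ := Function.ne_iff.1 ha0
  refine Finset.sum_lt_sum (fun j _ => ?_) ⟨i, Finset.mem_univ _, ?_⟩
  · nlinarith [sq_nonneg (a j), hlt j]
  · have : 0 < a i ^ 2 := sq_pos_of_ne_zero hi
    nlinarith [hlt i]

end CompactSymmetric

/-! ### Compactness of integrals of rank-one operators. -/

section IntegralOperator

variable {H : Type*} [NormedAddCommGroup H] [InnerProductSpace ℝ H]

theorem isCompactOperator_rankOne (u v : H) :
    IsCompactOperator (InnerProductSpace.rankOne ℝ u v : H →L[ℝ] H) := by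
  have h : (InnerProductSpace.rankOne ℝ u v : H →L[ℝ] H)
      = (ContinuousLinearMap.toSpanSingleton ℝ u).comp (innerSL ℝ v) := by
    ext w; simp [InnerProductSpace.rankOne_apply]
  rw [h]
  exact (isCompactOperator_of_locallyCompactSpace_rng
    (ContinuousLinearMap.toSpanSingleton ℝ u)).comp_clm _

/-- The integral can be formed inside the complete space `K` and commutes with the inclusion. It is
applied to the closed subspace of compact operators. -/
theorem integral_mem_of_isClosed {E : Type*} [NormedAddCommGroup E] [NormedSpace ℝ E]
    [CompleteSpace E] {K : Submodule ℝ E} (hK : IsClosed (K : Set E)) {f : ℝ → E}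
    (hf : Continuous f) {C : ℝ} (hC : ∀ x, ‖f x‖ ≤ C) (hfK : ∀ x, f x ∈ K)
    (ν : Measure ℝ) [IsFiniteMeasure ν] : ∫ x, f x ∂ν ∈ K := by
  have : CompleteSpace K := hK.completeSpace_coe
  have hg : Continuous fun x => (⟨f x, hfK x⟩ : K) := hf.subtype_mk hfK
  have hi : Integrable (fun x => (⟨f x, hfK x⟩ : K)) ν :=
    Integrable.of_bound hg.aestronglyMeasurable C (ae_of_all _ hC)
  have h := K.subtypeL.integral_comp_comm hi
  change ∫ x, f x ∂ν = _ at h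
  rw [h]
  exact (∫ x, (⟨f x, hfK x⟩ : K) ∂ν).2

/-- For a bounded continuous family `k` of vectors and a finite measure `ν` the operator
`∫ ⟨k x, ·⟩ k x dν(x)` is compact. -/
theorem exists_isCompactOperator_inner_eq_integral [CompleteSpace H] {k : ℝ → H}
    (hk : Continuous k) {C : ℝ} (hC : ∀ x, ‖k x‖ ≤ C) (ν : Measure ℝ) [IsFiniteMeasure ν] :
    ∃ T : H →L[ℝ] H, IsCompactOperator T ∧
      ∀ f g, inner ℝ (T f) g = ∫ x, inner ℝ (k x) f * inner ℝ (k x) g ∂ν := by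
  let R : ℝ → (H →L[ℝ] H) := fun x => InnerProductSpace.rankOne ℝ (k x) (k x)
  have hRc : Continuous R := by
    have h : R = fun x => (innerSL ℝ (k x)).smulRight (k x) := by
      funext x; exact InnerProductSpace.rankOne_def _ _
    rw [h]
    fun_prop
  have hRb : ∀ x, ‖R x‖ ≤ C * C := fun x => by
    rw [InnerProductSpace.norm_rankOne]
    exact mul_le_mul (hC x) (hC x) (norm_nonneg _) ((norm_nonneg _).trans (hC x))
  have hRi : Integrable R ν := Integrable.of_bound hRc.aestronglyMeasurable (C * C)
    (ae_of_all _ hRb)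
  refine ⟨∫ x, R x ∂ν, integral_mem_of_isClosed (K := compactOperator (RingHom.id ℝ) H H)
    isClosed_setOfPred_isCompactOperator hRc hRb (fun x => isCompactOperator_rankOne _ _) ν,
    fun f g => ?_⟩
  rw [ContinuousLinearMap.integral_apply hRi, real_inner_comm, ← integral_inner]
  · refine integral_congr_ae (ae_of_all _ fun x => ?_)
    change inner ℝ g ((InnerProductSpace.rankOne ℝ (k x) (k x) : H →L[ℝ] H) f) = _
    rw [InnerProductSpace.rankOne_apply, inner_smul_right, real_inner_comm (k x) g]
  · exact hRi.apply_continuousLinearMap f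

end IntegralOperator

/-! ### The space $H^1_0(0,1)$ as primitives of mean-zero functions. -/

noncomputable section

/-- The Hilbert space `L²(0,1)`. -/
abbrev GradSpace : Type := Lp ℝ 2 (volume.restrict (Ioo (0 : ℝ) 1))

/-- The indicator function of `(-∞, x]` in `L²(0,1)`. -/
def stepVec (x : ℝ) : GradSpace :=
  indicatorConstLp 2 (measurableSet_Iic : MeasurableSet (Iic x)) (measure_ne_top _ _) 1

/-- The length of `(0,1) ∩ (-∞, x]`. -/
def clamp (x : ℝ) : ℝ := max 0 (min x 1)

theorem measureReal_restrict_Iic (x : ℝ) :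
    (volume.restrict (Ioo (0 : ℝ) 1)).real (Iic x) = clamp x := by
  rw [measureReal_restrict_apply measurableSet_Iic, clamp]
  rcases lt_or_ge x 1 with h | h
  · have : Iic x ∩ Ioo (0 : ℝ) 1 = Ioc 0 x := by ext y; simp; grind
    rw [this, Real.volume_real_Ioc, min_eq_left h.le, sub_zero, max_comm]
  · have : Iic x ∩ Ioo (0 : ℝ) 1 = Ioo 0 1 := by ext y; simp; grind
    rw [this, Real.volume_real_Ioo, min_eq_right h]
    norm_num

theorem inner_stepVec_stepVec (x y : ℝ) :
    inner ℝ (stepVec x) (stepVec y) = clamp (min x y) := by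
  rw [stepVec, stepVec, L2.real_inner_indicatorConstLp_one_indicatorConstLp_one, Iic_inter_Iic,
    measureReal_restrict_Iic]

theorem clamp_of_mem {x : ℝ} (hx : x ∈ Icc (0 : ℝ) 1) : clamp x = x := by
  rw [clamp, min_eq_left hx.2, max_eq_right hx.1]

theorem clamp_of_le {x : ℝ} (hx : x ≤ 0) : clamp x = 0 := by
  rw [clamp, max_eq_left ((min_le_left _ _).trans hx)]

theorem clamp_of_ge {x : ℝ} (hx : 1 ≤ x) : clamp x = 1 := by
  rw [clamp, min_eq_right hx]; norm_num

theorem continuous_stepVec : Continuous stepVec := by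
  refine continuous_indicatorConstLp_set (by norm_num) fun x => ?_
  have hle : ∀ y, (volume.restrict (Ioo (0 : ℝ) 1)) (symmDiff (Iic y) (Iic x)) ≤ ENNReal.ofReal |y - x| := by
    intro y
    calc (volume.restrict (Ioo (0 : ℝ) 1)) (symmDiff (Iic y) (Iic x)) ≤ volume (symmDiff (Iic y) (Iic x)) :=
          Measure.restrict_apply_le _ _
      _ ≤ volume (uIoc x y) := by
          refine measure_mono fun z hz => ?_
          simp only [mem_symmDiff, mem_Iic, mem_uIoc] at hz ⊢
          grind
      _ = ENNReal.ofReal |y - x| := Real.volume_uIoc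
  refine tendsto_of_tendsto_of_tendsto_of_le_of_le tendsto_const_nhds ?_ (fun _ => zero_le) hle
  have : Tendsto (fun y : ℝ => ENNReal.ofReal |y - x|) (𝓝 x) (𝓝 (ENNReal.ofReal |x - x|)) := by
    refine ENNReal.tendsto_ofReal (Continuous.tendsto ?_ x)
    fun_prop
  simpa using this

/-- The representing vector of the evaluation at `x` on functions of `H¹₀(0,1)`. -/
def evalVec (x : ℝ) : GradSpace := stepVec x - clamp x • stepVec 1

theorem continuous_clamp : Continuous clamp := by unfold clamp; fun_prop

theorem continuous_evalVec : Continuous evalVec :=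
  continuous_stepVec.sub (continuous_clamp.smul continuous_const)

theorem norm_stepVec_le (x : ℝ) : ‖stepVec x‖ ≤ 1 := by
  have h : ‖stepVec x‖ ^ 2 ≤ 1 := by
    rw [← real_inner_self_eq_norm_sq, inner_stepVec_stepVec, clamp]
    simp
  nlinarith [norm_nonneg (stepVec x)]

theorem norm_evalVec_le (x : ℝ) : ‖evalVec x‖ ≤ 2 := by
  have h1 := norm_stepVec_le x
  have h2 := norm_stepVec_le 1
  have h3 : |clamp x| ≤ 1 := by rw [clamp, abs_le]; constructor <;> simp
  calc ‖evalVec x‖ ≤ ‖stepVec x‖ + ‖clamp x • stepVec 1‖ := norm_sub_le _ _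
    _ ≤ 1 + 1 * 1 := by
      rw [norm_smul, Real.norm_eq_abs]
      gcongr
    _ = 2 := by norm_num

/-- The element of `H¹₀(0,1)` whose gradient is `g` (up to the mean value of `g`). -/
def primitive : GradSpace →ₗ[ℝ] (ℝ → ℝ) where
  toFun g x := inner ℝ (evalVec x) g
  map_add' f g := by funext x; simp [inner_add_right]
  map_smul' c g := by funext x; simp [inner_smul_right]

theorem primitive_apply (g : GradSpace) (x : ℝ) : primitive g x = inner ℝ (evalVec x) g := rfl

theorem continuous_primitive (g : GradSpace) : Continuous (primitive g) :=
  continuous_evalVec.inner continuous_const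

theorem stepVec_of_ge {x : ℝ} (hx : 1 ≤ x) : stepVec x = stepVec 1 := by
  rw [← sub_eq_zero, ← norm_eq_zero, ← sq_eq_zero_iff, ← real_inner_self_eq_norm_sq]
  simp only [inner_sub_left, inner_sub_right, inner_stepVec_stepVec]
  simp [hx, clamp_of_ge]

theorem stepVec_of_le {x : ℝ} (hx : x ≤ 0) : stepVec x = 0 := by
  rw [← norm_eq_zero, ← sq_eq_zero_iff, ← real_inner_self_eq_norm_sq, inner_stepVec_stepVec,
    clamp_of_le (by simpa using hx)]

theorem evalVec_eq_zero {x : ℝ} (hx : x ∉ Ioo (0 : ℝ) 1) : evalVec x = 0 := by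
  rw [mem_Ioo, not_and_or, not_lt, not_lt] at hx
  rcases hx with h | h
  · rw [evalVec, stepVec_of_le h, clamp_of_le h]; simp
  · rw [evalVec, stepVec_of_ge h, clamp_of_ge h]; simp

theorem primitive_eq_zero (g : GradSpace) {x : ℝ} (hx : x ∉ Ioo (0 : ℝ) 1) :
    primitive g x = 0 := by
  rw [primitive_apply, evalVec_eq_zero hx, inner_zero_left]

/-- The functions in `L²(0,1)` with mean value zero. -/
def meanZero : Submodule ℝ GradSpace := LinearMap.ker (innerSL ℝ (stepVec 1) : GradSpace →ₗ[ℝ] ℝ)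

theorem mem_meanZero {g : GradSpace} : g ∈ meanZero ↔ inner ℝ (stepVec 1) g = 0 := Iff.rfl

theorem primitive_eq_inner_stepVec {g : GradSpace} (hg : g ∈ meanZero) (x : ℝ) :
    primitive g x = inner ℝ (stepVec x) g := by
  rw [primitive_apply, evalVec, inner_sub_left, inner_smul_left, mem_meanZero.1 hg]; simp

/-- Since `stepVec 1` is a unit vector, `evalVec x` is the orthogonal projection of `stepVec x` onto
`meanZero`. Hence `primitive` kills `stepVec 1`, which later makes eigenvectors for positive
eigenvalues automatically mean zero. -/
theorem evalVec_mem_meanZero (x : ℝ) : evalVec x ∈ meanZero := by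
  rw [mem_meanZero, evalVec, inner_sub_right, inner_smul_right, inner_stepVec_stepVec,
    inner_stepVec_stepVec, min_self, clamp_of_mem (x := 1) (by simp), mul_one]
  rcases le_total x 1 with h | h
  · rw [min_eq_right h, sub_self]
  · rw [min_eq_left h, clamp_of_ge h, clamp_of_ge le_rfl, sub_self]

theorem inner_stepVec_eq_integral (g : GradSpace) {x : ℝ} (hx : x ∈ Icc (0 : ℝ) 1) :
    inner ℝ (stepVec x) g = ∫ t in (0 : ℝ)..x, g t := by
  rw [stepVec, L2.inner_indicatorConstLp_one, Measure.restrict_restrict measurableSet_Iic,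
    intervalIntegral.integral_of_le hx.1]
  refine setIntegral_congr_set ?_
  have : (Iic x ∩ Ioo 0 1 : Set ℝ) =ᵐ[volume] (Iic x ∩ Ioc 0 1 : Set ℝ) :=
    (ae_eq_refl _).inter Ioo_ae_eq_Ioc
  have h2 : (Iic x ∩ Ioc 0 1 : Set ℝ) = Ioc 0 x := by
    have := hx.2
    ext y
    simp only [mem_inter_iff, mem_Iic, mem_Ioc]
    grind
  rwa [h2] at this

theorem intervalIntegrable_of_memLp {g : ℝ → ℝ} (hg : MemLp g 2 (volume.restrict (Ioo (0 : ℝ) 1)))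
    {a b : ℝ} (ha : a ∈ Icc (0 : ℝ) 1) (hb : b ∈ Icc (0 : ℝ) 1) :
    IntervalIntegrable g volume a b := by
  have h1 : IntegrableOn g (Ioo 0 1) := hg.integrable (by norm_num)
  have h2 : IntegrableOn g (Icc 0 1) := by rwa [integrableOn_Icc_iff_integrableOn_Ioo]
  exact (h2.mono_set (uIcc_subset_Icc ha hb)).intervalIntegrable

theorem isWeakGradient_primitive {g : GradSpace} (hg : g ∈ meanZero) :
    IsWeakGradient (primitive g) g := by
  refine ⟨Lp.memLp g, fun x hx => ?_⟩
  rw [primitive_eq_zero g (x := 0) (by simp), zero_add, primitive_eq_inner_stepVec hg,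
    inner_stepVec_eq_integral g hx]

/-- Lebesgue differentiation: the primitive has derivative `g` almost everywhere, and it is
constant. -/
theorem ae_eq_zero_of_forall_integral_eq_zero {g : ℝ → ℝ}
    (hg : MemLp g 2 (volume.restrict (Ioo (0 : ℝ) 1)))
    (h : ∀ x ∈ Icc (0 : ℝ) 1, ∫ t in (0 : ℝ)..x, g t = 0) :
    g =ᵐ[volume.restrict (Ioo (0 : ℝ) 1)] 0 := by
  have hi := intervalIntegrable_of_memLp hg (a := 0) (b := 1) (by simp) (by simp)
  rw [EventuallyEq, ae_restrict_iff' measurableSet_Ioo]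
  filter_upwards [hi.ae_hasDerivAt_integral] with x hx hx1
  rw [uIcc_of_le zero_le_one] at hx
  have h1 := hx (Ioo_subset_Icc_self hx1) 0 (by simp)
  have h2 : HasDerivAt (fun x => ∫ t in (0 : ℝ)..x, g t) 0 x := by
    refine (hasDerivAt_const x (0 : ℝ)).congr_of_eventuallyEq ?_
    filter_upwards [Ioo_mem_nhds hx1.1 hx1.2] with y hy
    exact h y (Ioo_subset_Icc_self hy)
  exact h1.unique h2

theorem IsWeakGradient.ae_eq {f g h : ℝ → ℝ} (hg : IsWeakGradient f g) (hh : IsWeakGradient f h) :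
    g =ᵐ[volume.restrict (Ioo (0 : ℝ) 1)] h := by
  have h0 := ae_eq_zero_of_forall_integral_eq_zero (hg.1.sub hh.1) fun x hx => by
    have e1 := hg.2 x hx
    have e2 := hh.2 x hx
    have e3 := intervalIntegral.integral_sub
      (intervalIntegrable_of_memLp hg.1 (a := 0) (by simp) hx)
      (intervalIntegrable_of_memLp hh.1 (a := 0) (by simp) hx)
    simp only [Pi.sub_apply]
    rw [e3]; linarith
  filter_upwards [h0] with x hx
  simpa [sub_eq_zero] using hx

theorem weakGradient_primitive {g : GradSpace} (hg : g ∈ meanZero) :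
    weakGradient (primitive g) =ᵐ[volume.restrict (Ioo (0 : ℝ) 1)] g := by
  have hex : ∃ h, IsWeakGradient (primitive g) h := ⟨g, isWeakGradient_primitive hg⟩
  rw [weakGradient, dif_pos hex]
  exact hex.choose_spec.ae_eq (isWeakGradient_primitive hg)

theorem energy_primitive {g h : GradSpace} (hg : g ∈ meanZero) (hh : h ∈ meanZero) :
    energy (primitive g) (primitive h) = inner ℝ g h := by
  rw [energy, L2.inner_def]
  refine integral_congr_ae ?_
  filter_upwards [weakGradient_primitive hg, weakGradient_primitive hh] with x h1 h2
  rw [h1, h2]; simp [mul_comm]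

theorem primitive_mem_H10 {g : GradSpace} (hg : g ∈ meanZero) : primitive g ∈ H10 :=
  ⟨⟨g, isWeakGradient_primitive hg⟩, fun _ hx => primitive_eq_zero g hx⟩

/-- Together with `primitive_mem_H10`, `energy_primitive` and `eq_zero_of_primitive_eq_zero` this
identifies $H^1_0(0,1)$ with the Hilbert space `meanZero`. -/
theorem exists_primitive_eq {f : ℝ → ℝ} (hf : f ∈ H10) : ∃ g ∈ meanZero, primitive g = f := by
  obtain ⟨⟨G, hGm, hGi⟩, h0⟩ := hf
  have hae : (hGm.toLp G : GradSpace) =ᵐ[volume.restrict (Ioo (0 : ℝ) 1)] G := hGm.coeFn_toLp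
  have hint : ∀ x ∈ Icc (0 : ℝ) 1, inner ℝ (stepVec x) (hGm.toLp G : GradSpace) = f x := by
    intro x hx
    rw [inner_stepVec_eq_integral _ hx, hGi x hx, h0 0 (by simp), zero_add]
    refine intervalIntegral.integral_congr_ae' ?_ ?_
    · have h1 := (ae_restrict_iff' measurableSet_Ioo).1 hae
      have h2 : ∀ᵐ y : ℝ, y ≠ 1 := by simp [ae_iff, measure_singleton]
      filter_upwards [h1, h2] with y hy hy1 hyx
      exact hy ⟨hyx.1, lt_of_le_of_ne (hyx.2.trans hx.2) hy1⟩
    · exact ae_of_all _ fun y hy => absurd (hy.1.trans_le hy.2) (not_lt.2 hx.1)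
  have hmem : (hGm.toLp G : GradSpace) ∈ meanZero := by
    rw [mem_meanZero, hint 1 (by simp), h0 1 (by simp)]
  refine ⟨_, hmem, funext fun x => ?_⟩
  by_cases hx : x ∈ Ioo (0 : ℝ) 1
  · rw [primitive_eq_inner_stepVec hmem, hint x (Ioo_subset_Icc_self hx)]
  · rw [primitive_eq_zero _ hx, h0 x hx]

theorem eq_zero_of_primitive_eq_zero {g : GradSpace} (hg : g ∈ meanZero) (h : primitive g = 0) :
    g = 0 := by
  have h0 := ae_eq_zero_of_forall_integral_eq_zero (Lp.memLp g) fun x hx => by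
    rw [← inner_stepVec_eq_integral g hx, ← primitive_eq_inner_stepVec hg, h, Pi.zero_apply]
  exact (Lp.eq_zero_iff_ae_eq_zero).2 h0

theorem integrable_primitive_mul (ν : Measure ℝ) [IsFiniteMeasure ν] (g h : GradSpace) :
    Integrable (fun x => primitive g x * primitive h x) ν := by
  refine Integrable.of_bound ((continuous_primitive g).mul
    (continuous_primitive h)).aestronglyMeasurable ((2 * ‖g‖) * (2 * ‖h‖)) (ae_of_all _ fun x => ?_)
  have hb : ∀ u : GradSpace, ‖primitive u x‖ ≤ 2 * ‖u‖ := fun u =>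
    (norm_inner_le_norm _ _).trans (mul_le_mul_of_nonneg_right (norm_evalVec_le x) (norm_nonneg _))
  rw [norm_mul]
  exact mul_le_mul (hb g) (hb h) (norm_nonneg _) (by positivity)

/-! ### Trapezoidal test functions. -/

/-- The gradient of the trapezoidal function which vanishes outside `[a, d]` and is `1` on
`[b, c]`. -/
def tentVec (a b c d : ℝ) : GradSpace :=
  (b - a)⁻¹ • (stepVec b - stepVec a) - (d - c)⁻¹ • (stepVec d - stepVec c)

section Tent

variable {a b c d : ℝ} (ha : 0 ≤ a) (hab : a < b) (hbc : b ≤ c) (hcd : c < d) (hd : d ≤ 1)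

theorem inner_stepVec_tentVec (a b c d y : ℝ) : inner ℝ (stepVec y) (tentVec a b c d) =
    (b - a)⁻¹ * (clamp (min y b) - clamp (min y a)) -
      (d - c)⁻¹ * (clamp (min y d) - clamp (min y c)) := by
  simp only [tentVec, inner_sub_right, inner_smul_right, inner_stepVec_stepVec]

include ha hab hbc hcd hd

theorem inner_stepVec_tentVec_of_ge {y : ℝ} (hy : d ≤ y) :
    inner ℝ (stepVec y) (tentVec a b c d) = 0 := by
  rw [inner_stepVec_tentVec, min_eq_right hy, min_eq_right (by linarith),
    min_eq_right (by linarith), min_eq_right (by linarith), clamp_of_mem ⟨by linarith, by linarith⟩,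
    clamp_of_mem ⟨by linarith, by linarith⟩, clamp_of_mem ⟨by linarith, by linarith⟩,
    clamp_of_mem ⟨by linarith, by linarith⟩, inv_mul_cancel₀ (by linarith),
    inv_mul_cancel₀ (by linarith), sub_self]

theorem tentVec_mem_meanZero : tentVec a b c d ∈ meanZero :=
  inner_stepVec_tentVec_of_ge ha hab hbc hcd hd hd

theorem primitive_tentVec_of_ge {y : ℝ} (hy : d ≤ y) : primitive (tentVec a b c d) y = 0 := by
  rw [primitive_eq_inner_stepVec (tentVec_mem_meanZero ha hab hbc hcd hd),
    inner_stepVec_tentVec_of_ge ha hab hbc hcd hd hy]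

theorem primitive_tentVec_of_le {y : ℝ} (hy : y ≤ a) : primitive (tentVec a b c d) y = 0 := by
  rw [primitive_eq_inner_stepVec (tentVec_mem_meanZero ha hab hbc hcd hd),
    inner_stepVec_tentVec, min_eq_left hy, min_eq_left (by linarith),
    min_eq_left (by linarith), min_eq_left (by linarith)]
  ring

theorem primitive_tentVec_of_mem {y : ℝ} (hy : y ∈ Icc b c) :
    primitive (tentVec a b c d) y = 1 := by
  have h1 := hy.1
  have h2 := hy.2
  rw [primitive_eq_inner_stepVec (tentVec_mem_meanZero ha hab hbc hcd hd),
    inner_stepVec_tentVec, min_eq_right h1, min_eq_right (by linarith),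
    min_eq_left (by linarith), min_eq_left h2, clamp_of_mem ⟨by linarith, by linarith⟩,
    clamp_of_mem ⟨by linarith, by linarith⟩, inv_mul_cancel₀ (by linarith)]
  ring

-- Pairing with a trapezoid sees only the mean slopes of `primitive v` over its two flanks. Norms,
-- orthogonality and affinity off the support are all read off from this.
omit ha hab hbc hcd hd in
theorem inner_tentVec {v : GradSpace} (hv : v ∈ meanZero) : inner ℝ (tentVec a b c d) v =
    (b - a)⁻¹ * (primitive v b - primitive v a) -
      (d - c)⁻¹ * (primitive v d - primitive v c) := by
  simp [tentVec, inner_sub_left, inner_smul_left, primitive_eq_inner_stepVec hv]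

theorem norm_tentVec_sq : ‖tentVec a b c d‖ ^ 2 = (b - a)⁻¹ + (d - c)⁻¹ := by
  rw [← real_inner_self_eq_norm_sq, inner_tentVec (tentVec_mem_meanZero ha hab hbc hcd hd),
    primitive_tentVec_of_mem ha hab hbc hcd hd ⟨le_rfl, hbc⟩,
    primitive_tentVec_of_mem ha hab hbc hcd hd ⟨hbc, le_rfl⟩,
    primitive_tentVec_of_le ha hab hbc hcd hd le_rfl,
    primitive_tentVec_of_ge ha hab hbc hcd hd le_rfl]
  ring

end Tent

/-! ### From eigenvectors of the operator to eigenfunctions of the form. -/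

/-- A function on an interval all of whose three point chords have equal slopes is affine. -/
theorem exists_affine_of_slopes {J : Set ℝ} {F : ℝ → ℝ}
    (h : ∀ c ∈ J, ∀ d ∈ J, ∀ m, c < m → m < d →
      (m - c)⁻¹ * (F m - F c) = (d - m)⁻¹ * (F d - F m)) {x : ℝ} (hx : x ∈ J) :
    ∃ m c : ℝ, ∀ y ∈ J, F y = m * y + c := by
  by_cases hJ : ∃ y ∈ J, y ≠ x
  · obtain ⟨p, hp, q, hq, hpq⟩ : ∃ p ∈ J, ∃ q ∈ J, p < q := by
      obtain ⟨y, hy, hyx⟩ := hJ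
      rcases lt_or_gt_of_ne hyx with h1 | h1
      · exact ⟨y, hy, x, hx, h1⟩
      · exact ⟨x, hx, y, hy, h1⟩
    have hqp : q - p ≠ 0 := by linarith
    refine ⟨(F q - F p) / (q - p), F p - (F q - F p) / (q - p) * p, fun y hy => ?_⟩
    have key : ∀ c d m : ℝ, c < m → m < d → (m - c)⁻¹ * (F m - F c) = (d - m)⁻¹ * (F d - F m) →
        (d - m) * (F m - F c) = (m - c) * (F d - F m) := by
      intro c d m h1 h2 h3
      have h4 : m - c ≠ 0 := by linarith
      have h5 : d - m ≠ 0 := by linarith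
      field_simp at h3
      linarith
    have goal : (F y - F p) * (q - p) = (F q - F p) * (y - p) := by
      rcases lt_trichotomy y p with h1 | h1 | h1
      · linarith [key y q p h1 hpq (h y hy q hq p h1 hpq)]
      · rw [h1]; ring
      · rcases lt_trichotomy y q with h2 | h2 | h2
        · linarith [key p q y h1 h2 (h p hp q hq y h1 h2)]
        · rw [h2]
        · linarith [key p y q hpq h2 (h p hp y hy q hpq h2)]
    field_simp
    linarith
  · push Not at hJ
    exact ⟨0, F x, fun y hy => by rw [hJ y hy]; ring⟩

section Operator

variable {ν : Measure ℝ} {T : GradSpace →L[ℝ] GradSpace}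
  (hT : ∀ f g, inner ℝ (T f) g = ∫ x, primitive f x * primitive g x ∂ν)

include hT

theorem inner_eq_of_apply_eq_smul {μ : ℝ} (hμ : 0 < μ) {v : GradSpace} (hv : T v = μ • v)
    (h : GradSpace) : inner ℝ v h = μ⁻¹ * ∫ x, primitive v x * primitive h x ∂ν := by
  rw [← hT, hv, inner_smul_left]
  simp [hμ.ne']

theorem mem_meanZero_of_apply_eq_smul {μ : ℝ} (hμ : 0 < μ) {v : GradSpace} (hv : T v = μ • v) :
    v ∈ meanZero := by
  rw [mem_meanZero, real_inner_comm, inner_eq_of_apply_eq_smul hT hμ hv]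
  have : ∀ x, primitive (stepVec 1) x = 0 := fun x => by
    rw [primitive_apply, real_inner_comm]; exact mem_meanZero.1 (evalVec_mem_meanZero x)
  simp [this]

/-- A tent over `[c, d]` inside a component of the complement of the support sees no mass of `ν`.
Testing the eigenvalue equation with it shows that the slopes on the two sides of its apex agree. -/
theorem isAffineOffSupport_primitive {μ : ℝ} (hμ : 0 < μ) {v : GradSpace} (hv : T v = μ • v) :
    IsAffineOffSupport ν (primitive v) := by
  intro x hx
  have hvm := mem_meanZero_of_apply_eq_smul hT hμ hv
  set J := connectedComponentIn (Icc (0 : ℝ) 1 \ ν.support) x with hJ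
  have hJsub : J ⊆ Icc (0 : ℝ) 1 \ ν.support := connectedComponentIn_subset _ _
  have hJo : J.OrdConnected := isPreconnected_connectedComponentIn.ordConnected
  refine exists_affine_of_slopes (fun c hc d hd m hcm hmd => ?_) (mem_connectedComponentIn hx)
  have h0 := (hJsub hc).1.1
  have h1 := (hJsub hd).1.2
  have hin := inner_tentVec (a := c) (b := m) (c := m) (d := d) hvm
  rw [real_inner_comm, inner_eq_of_apply_eq_smul hT hμ hv] at hin
  have hz : ∫ x, primitive v x * primitive (tentVec c m m d) x ∂ν = 0 := by
    have hae : (fun x => primitive v x * primitive (tentVec c m m d) x) =ᵐ[ν] 0 := by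
      filter_upwards [Measure.support_mem_ae (μ := ν)] with y hy
      have hyJ : y ∉ Icc c d := fun hycd => (hJsub (hJo.out hc hd hycd)).2 hy
      rw [mem_Icc, not_and_or, not_le, not_le] at hyJ
      rcases hyJ with h | h
      · rw [primitive_tentVec_of_le h0 hcm le_rfl hmd h1 h.le]; simp
      · rw [primitive_tentVec_of_ge h0 hcm le_rfl hmd h1 h.le]; simp
    rw [integral_congr_ae hae]; simp
  rw [hz, mul_zero] at hin
  linarith

theorem isEigenfunction_primitive {μ : ℝ} (hμ : 0 < μ) {v : GradSpace} (hv : T v = μ • v)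
    (hv0 : v ≠ 0) : IsEigenfunction ν μ⁻¹ (primitive v) := by
  have hvm := mem_meanZero_of_apply_eq_smul hT hμ hv
  refine ⟨⟨primitive_mem_H10 hvm, isAffineOffSupport_primitive hT hμ hv⟩,
    fun h => hv0 (eq_zero_of_primitive_eq_zero hvm h), fun g hg => ?_⟩
  obtain ⟨h, hh, rfl⟩ := exists_primitive_eq hg.1
  rw [energy_primitive hvm hh, inner_eq_of_apply_eq_smul hT hμ hv]

theorem upperEigenspan_le_meanZero {c : ℝ} (hc : 0 < c) : upperEigenspan T c ≤ meanZero := by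
  refine Submodule.span_le.2 ?_
  rintro v ⟨μ, hμ, hv⟩
  exact mem_meanZero_of_apply_eq_smul hT (hc.trans_le hμ) hv

/-- Eigenvalues `μ ≥ x⁻¹` of `T` become form eigenvalues `μ⁻¹ ≤ x`, and `primitive` is injective on
`meanZero`. Only this inequality is needed: the upper bound for the count works directly with the
eigenfunctions. -/
theorem rank_upperEigenspan_le {x : ℝ} (hx : 0 < x) :
    Module.rank ℝ (upperEigenspan T x⁻¹) ≤
      Module.rank ℝ (Submodule.span ℝ {f : ℝ → ℝ | ∃ l ≤ x, IsEigenfunction ν l f}) := by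
  have hx' : 0 < x⁻¹ := inv_pos.2 hx
  have hmap : ∀ v : upperEigenspan T x⁻¹, (primitive ∘ₗ (upperEigenspan T x⁻¹).subtype) v ∈
      Submodule.span ℝ {f : ℝ → ℝ | ∃ l ≤ x, IsEigenfunction ν l f} := by
    rintro ⟨v, hv⟩
    refine Submodule.span_induction (p := fun v _ => primitive v ∈
      Submodule.span ℝ {f : ℝ → ℝ | ∃ l ≤ x, IsEigenfunction ν l f}) ?_ ?_ ?_ ?_ hv
    · rintro w ⟨μ, hμ, hw⟩
      by_cases hw0 : w = 0
      · rw [hw0, map_zero]; exact Submodule.zero_mem _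
      · exact Submodule.subset_span ⟨μ⁻¹, (inv_le_comm₀ hx (hx'.trans_le hμ)).1 hμ,
          isEigenfunction_primitive hT (hx'.trans_le hμ) hw hw0⟩
    · rw [map_zero]; exact Submodule.zero_mem _
    · intro u w _ _ hu hw; rw [map_add]; exact Submodule.add_mem _ hu hw
    · intro a u _ hu; rw [map_smul]; exact Submodule.smul_mem _ _ hu
  refine LinearMap.rank_le_of_injective (LinearMap.codRestrict _ _ hmap) ?_
  rw [← LinearMap.ker_eq_bot, LinearMap.ker_codRestrict, LinearMap.ker_eq_bot']
  rintro ⟨v, hv⟩ h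
  exact Subtype.ext (eq_zero_of_primitive_eq_zero (upperEigenspan_le_meanZero hT hx' hv) h)

end Operator

theorem exists_operator (ν : Measure ℝ) [IsFiniteMeasure ν] :
    ∃ T : GradSpace →L[ℝ] GradSpace, IsCompactOperator T ∧ (T : GradSpace →ₗ[ℝ] GradSpace).IsSymmetric ∧
      ∀ f g, inner ℝ (T f) g = ∫ x, primitive f x * primitive g x ∂ν := by
  obtain ⟨T, hT, h⟩ := exists_isCompactOperator_inner_eq_integral continuous_evalVec
    norm_evalVec_le ν
  refine ⟨T, hT, fun f g => ?_, h⟩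
  rw [ContinuousLinearMap.coe_coe, h, real_inner_comm, h]
  simp only [mul_comm]

/-! ### Counting eigenvalues from below. -/

/-- Disjointly supported trapezoids of small Rayleigh quotient bound the number of eigenvalues from
below. -/
theorem card_le_eigenvalueCount (ν : Measure ℝ) [IsFiniteMeasure ν] {ι : Type*} [Fintype ι]
    {a b c d : ι → ℝ} (ha : ∀ i, 0 ≤ a i) (hab : ∀ i, a i < b i) (hbc : ∀ i, b i ≤ c i)
    (hcd : ∀ i, c i < d i) (hd : ∀ i, d i ≤ 1)
    (hdisj : ∀ i j, i ≠ j → d i ≤ a j ∨ d j ≤ a i) {x : ℝ} (hx : 0 < x)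
    (hlt : ∀ i, (b i - a i)⁻¹ + (d i - c i)⁻¹ < x * ν.real (Icc (b i) (c i))) :
    (Fintype.card ι : ℕ∞) ≤ eigenvalueCount ν x := by
  obtain ⟨T, hTc, hTs, hT⟩ := exists_operator ν
  let v : ι → GradSpace := fun i => tentVec (a i) (b i) (c i) (d i)
  have hge : ∀ i y, d i ≤ y → primitive (v i) y = 0 := fun i y hy =>
    primitive_tentVec_of_ge (ha i) (hab i) (hbc i) (hcd i) (hd i) hy
  have hle : ∀ i y, y ≤ a i → primitive (v i) y = 0 := fun i y hy =>
    primitive_tentVec_of_le (ha i) (hab i) (hbc i) (hcd i) (hd i) hy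
  have hmem : ∀ i, v i ∈ meanZero := fun i =>
    tentVec_mem_meanZero (ha i) (hab i) (hbc i) (hcd i) (hd i)
  have hprod : ∀ i j, i ≠ j → ∀ y, primitive (v i) y * primitive (v j) y = 0 := by
    intro i j hij y
    rcases hdisj i j hij with h | h
    · rcases le_total (d i) y with h1 | h1
      · rw [hge i y h1, zero_mul]
      · rw [hle j y (h1.trans h), mul_zero]
    · rcases le_total (d j) y with h1 | h1
      · rw [hge j y h1, mul_zero]
      · rw [hle i y (h1.trans h), zero_mul]
  -- By `inner_tentVec` only the values of `primitive (v j)` at the four nodes of trapezoid `i`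
  -- matter, and these all vanish.
  have horth : ∀ i j, i ≠ j → inner ℝ (v i) (v j) = 0 := by
    intro i j hij
    have h1 := hab i
    have h2 := hbc i
    have h3 := hcd i
    rw [inner_tentVec (hmem j)]
    rcases hdisj i j hij with h | h
    · rw [hle j _ h, hle j (a i) (by linarith), hle j (b i) (by linarith),
        hle j (c i) (by linarith)]; simp
    · rw [hge j _ h, hge j (b i) (by linarith), hge j (c i) (by linarith),
        hge j (d i) (by linarith)]; simp
  have hcard := card_le_rank_upperEigenspan hTc hTs (c := x⁻¹) horth
    (fun i j hij => by rw [hT]; simp [hprod i j hij]) (fun i => by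
      rw [norm_tentVec_sq (ha i) (hab i) (hbc i) (hcd i) (hd i), hT]
      have h1 : ν.real (Icc (b i) (c i)) ≤ ∫ y, primitive (v i) y * primitive (v i) y ∂ν := by
        have h2 : ν.real (Icc (b i) (c i)) = ∫ y, (Icc (b i) (c i)).indicator 1 y ∂ν := by
          rw [integral_indicator_one measurableSet_Icc]
        rw [h2]
        refine integral_mono ((integrable_const 1).indicator measurableSet_Icc)
          (integrable_primitive_mul ν _ _) fun y => ?_
        by_cases hy : y ∈ Icc (b i) (c i)
        · rw [indicator_of_mem hy]
          simp [v, primitive_tentVec_of_mem (ha i) (hab i) (hbc i) (hcd i) (hd i) hy]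
        · rw [indicator_of_notMem hy]; exact mul_self_nonneg _
      rw [inv_mul_lt_iff₀ hx]
      exact (hlt i).trans_le (mul_le_mul_of_nonneg_left h1 hx.le))
  have h := hcard.trans (rank_upperEigenspan_le hT hx)
  have hcount := Cardinal.toENat.monotone' h
  rw [eigenvalueCount]
  simpa using hcount

/-! ### Counting eigenvalues from above by dyadic cells. -/

/-- On the span of the eigenfunctions with eigenvalues at most `x` the form is at most `x` times the
inner product of `L²(ν)`. -/
theorem exists_norm_sq_le_of_mem_span {ν : Measure ℝ} [IsFiniteMeasure ν] {x : ℝ} {f : ℝ → ℝ}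
    (hf : f ∈ Submodule.span ℝ {f : ℝ → ℝ | ∃ l ≤ x, IsEigenfunction ν l f}) :
    ∃ g ∈ meanZero, primitive g = f ∧ ‖g‖ ^ 2 ≤ x * ∫ y, f y * f y ∂ν := by
  obtain ⟨n, c, F, rfl⟩ := Submodule.mem_span_set'.1 hf
  obtain ⟨T, -, -, hT⟩ := exists_operator ν
  choose l hl hF using fun i => (F i).2
  choose g hgm hgF using fun i => exists_primitive_eq (hF i).1.1
  have hin : ∀ i j, inner ℝ (g i) (g j) = l i * inner ℝ (T (g i)) (g j) := by
    intro i j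
    rw [← energy_primitive (hgm i) (hgm j), hgF, hgF, (hF i).2.2 _ (hF j).1, hT, hgF, hgF]
  have hTsymm : ∀ i j, inner ℝ (T (g i)) (g j) = inner ℝ (T (g j)) (g i) := by
    intro i j; rw [hT, hT]; simp only [mul_comm]
  -- Eigenfunctions for different eigenvalues are orthogonal in $L^2(\nu)$, so `x - l i` may be
  -- replaced by a symmetric product of square roots. This writes $x\int f^2\,d\nu-\mathcal E(f,f)$
  -- as $\langle Tw,w\rangle\ge0$ with `w` the combination with coefficients `c i * √(x - l i)`.
  have hsqrt : ∀ i j, (x - l i) * inner ℝ (T (g i)) (g j) =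
      √(x - l i) * √(x - l j) * inner ℝ (T (g i)) (g j) := by
    intro i j
    have h1 := hin i j
    have h2 := hin j i
    rw [real_inner_comm, h1, hTsymm j i] at h2
    rcases mul_eq_mul_right_iff.1 h2 with h | h
    · rw [h, Real.mul_self_sqrt (by linarith [hl j])]
    · rw [h, mul_zero, mul_zero]
  refine ⟨∑ i, c i • g i, Submodule.sum_mem _ fun i _ => Submodule.smul_mem _ _ (hgm i), ?_, ?_⟩
  · rw [map_sum]
    exact Finset.sum_congr rfl fun i _ => by rw [map_smul, hgF]
  · have hprim : primitive (∑ i, c i • g i) = ∑ i, c i • (F i : ℝ → ℝ) := by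
      rw [map_sum]
      exact Finset.sum_congr rfl fun i _ => by rw [map_smul, hgF]
    rw [← hprim, ← hT, ← real_inner_self_eq_norm_sq]
    have h0 : 0 ≤ inner ℝ (T (∑ i, (c i * √(x - l i)) • g i)) (∑ i, (c i * √(x - l i)) • g i) := by
      rw [hT]; exact integral_nonneg fun y => mul_self_nonneg _
    simp only [map_sum, map_smul, sum_inner, inner_sum, inner_smul_left, inner_smul_right] at h0 ⊢
    simp only [Finset.mul_sum, conj_trivial] at h0 ⊢
    rw [← sub_nonneg, ← Finset.sum_sub_distrib]
    refine h0.trans (le_of_eq (Finset.sum_congr rfl fun i _ => ?_))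
    rw [← Finset.sum_sub_distrib]
    refine Finset.sum_congr rfl fun j _ => ?_
    rw [hin j i]
    linear_combination (-(c i * c j)) * hsqrt j i

theorem sq_intervalIntegral_le {g : ℝ → ℝ} (hg : MemLp g 2 (volume.restrict (Ioo (0 : ℝ) 1)))
    {a b y : ℝ} (ha : 0 ≤ a) (hy : y ∈ Icc a b) (hb : b ≤ 1) :
    (∫ t in a..y, g t) ^ 2 ≤ (b - a) * ∫ t in Ioc a b, g t ^ 2 := by
  have hsub : Ioc a b ⊆ Ioc 0 1 := Ioc_subset_Ioc ha hb
  have hg2 : IntegrableOn (fun t => g t ^ 2) (Ioc 0 1) := by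
    rw [integrableOn_Ioc_iff_integrableOn_Ioo]; exact hg.integrable_sq
  have hg1 : IntegrableOn g (Ioc 0 1) := by
    rw [integrableOn_Ioc_iff_integrableOn_Ioo]; exact hg.integrable (by norm_num)
  have hmono : ∫ t in Ioc a y, g t ^ 2 ≤ ∫ t in Ioc a b, g t ^ 2 :=
    setIntegral_mono_set (hg2.mono_set hsub) (ae_of_all _ fun _ => sq_nonneg _)
      (Ioc_subset_Ioc_right hy.2).eventuallyLE
  have hsub' : Ioc a y ⊆ Ioc 0 1 := (Ioc_subset_Ioc_right hy.2).trans hsub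
  have hnn : 0 ≤ ∫ t in Ioc a y, g t ^ 2 := integral_nonneg fun _ => sq_nonneg _
  rw [intervalIntegral.integral_of_le hy.1]
  have hexp : ∀ c : ℝ, 0 ≤ (∫ t in Ioc a y, g t ^ 2) - 2 * c * (∫ t in Ioc a y, g t)
      + c ^ 2 * (y - a) := by
    intro c
    have h1 : 0 ≤ ∫ t in Ioc a y, (g t - c) ^ 2 := integral_nonneg fun _ => sq_nonneg _
    have h2 : ∀ t, (g t - c) ^ 2 = g t ^ 2 - 2 * c * g t + c ^ 2 := fun t => by ring
    simp only [h2] at h1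
    have h3 : IntegrableOn (fun t => 2 * c * g t) (Ioc a y) := (hg1.mono_set hsub').const_mul _
    have h4 : IntegrableOn (fun t => g t ^ 2 - 2 * c * g t) (Ioc a y) :=
      (hg2.mono_set hsub').sub h3
    rw [integral_add h4 (integrable_const _), integral_sub (hg2.mono_set hsub') h3,
      integral_const_mul, integral_const] at h1
    simpa [hy.1, mul_comm] using h1
  rcases eq_or_lt_of_le hy.1 with h | h
  · rw [← h]; simp only [Ioc_self, setIntegral_empty]
    have := hnn.trans hmono
    nlinarith [hy.2]
  · set I := ∫ t in Ioc a y, g t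
    -- The mean value of `g` is the optimal constant and gives the Cauchy–Schwarz inequality.
    have h3 := hexp (I / (y - a))
    have h4 : 0 < y - a := by linarith
    have h5 : I ^ 2 ≤ (y - a) * ∫ t in Ioc a y, g t ^ 2 := by
      field_simp at h3
      nlinarith
    have := hy.2
    nlinarith

theorem dyadicCell_eq_union (n k : ℕ) :
    dyadicCell n k = dyadicCell (n + 1) (2 * k) ∪ dyadicCell (n + 1) (2 * k + 1) := by
  have h1 : ((2 * k : ℕ) : ℝ) / 2 ^ (n + 1) = k / 2 ^ n := by
    push_cast; rw [pow_succ]; field_simp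
  have h2 : (((2 * k + 1 : ℕ) : ℝ) + 1) / 2 ^ (n + 1) = (k + 1) / 2 ^ n := by
    push_cast; rw [pow_succ]; field_simp; ring
  have h3 : ((2 * k + 1 : ℕ) : ℝ) / 2 ^ (n + 1) = ((2 * k : ℕ) + 1 : ℝ) / 2 ^ (n + 1) := by
    push_cast; ring
  rw [dyadicCell, dyadicCell, dyadicCell, h1, h2, h3, Ioc_union_Ioc_eq_Ioc]
  · rw [← h1]; gcongr; linarith
  · rw [← h2]; gcongr; linarith

theorem disjoint_dyadicCell {n j k : ℕ} (h : j ≠ k) :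
    Disjoint (dyadicCell n j) (dyadicCell n k) := by
  wlog hjk : j < k generalizing j k
  · exact (this h.symm (by omega)).symm
  rw [dyadicCell, dyadicCell, Ioc_disjoint_Ioc]
  refine (min_le_left _ _).trans (le_trans ?_ (le_max_right _ _))
  gcongr
  exact_mod_cast hjk

theorem measurableSet_dyadicCell (n k : ℕ) : MeasurableSet (dyadicCell n k) := measurableSet_Ioc

theorem dyadicCell_subset {n k : ℕ} (hk : k < 2 ^ n) : dyadicCell n k ⊆ Ioc 0 1 := by
  refine Ioc_subset_Ioc (by positivity) ?_
  rw [div_le_one (by positivity)]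
  exact_mod_cast hk

/-- Poincaré inequality: with a zero at the left endpoint, $f^2\le\Lambda(C)\int_C g^2$ pointwise on
the cell, and this is integrated against `ν`. -/
theorem setIntegral_primitive_sq_le {ν : Measure ℝ} [IsFiniteMeasure ν] {g : GradSpace}
    (hg : g ∈ meanZero) {n k : ℕ} (hk : k < 2 ^ n) (h0 : primitive g (k / 2 ^ n) = 0) :
    ∫ y in dyadicCell n k, primitive g y ^ 2 ∂ν ≤
      ν.real (dyadicCell n k) / 2 ^ n * ∫ y in dyadicCell n k, g y ^ 2 := by
  have ha : (0 : ℝ) ≤ k / 2 ^ n := by positivity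
  have hb : ((k : ℝ) + 1) / 2 ^ n ≤ 1 := by
    rw [div_le_one (by positivity)]; exact_mod_cast hk
  have hpt : ∀ y ∈ dyadicCell n k,
      primitive g y ^ 2 ≤ (2 ^ n)⁻¹ * ∫ t in dyadicCell n k, g t ^ 2 := by
    intro y hy
    have hy1 : (k : ℝ) / 2 ^ n < y := hy.1
    have hy2 : y ≤ ((k : ℝ) + 1) / 2 ^ n := hy.2
    have hay : (k : ℝ) / 2 ^ n ∈ Icc (0 : ℝ) 1 := ⟨ha, by linarith⟩
    have hyI : y ∈ Icc (0 : ℝ) 1 := ⟨by linarith, by linarith⟩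
    have h1 : primitive g y = ∫ t in ((k : ℝ) / 2 ^ n)..y, g t := by
      have e1 := inner_stepVec_eq_integral g hyI
      have e2 := inner_stepVec_eq_integral g hay
      rw [← primitive_eq_inner_stepVec hg] at e1 e2
      rw [← intervalIntegral.integral_interval_sub_left
        (intervalIntegrable_of_memLp (Lp.memLp g) (a := 0) (by simp) hyI)
        (intervalIntegrable_of_memLp (Lp.memLp g) (a := 0) (by simp) hay), ← e1, ← e2, h0, sub_zero]
    rw [h1]
    refine (sq_intervalIntegral_le (Lp.memLp g) ha ⟨hy1.le, hy2⟩ hb).trans (le_of_eq ?_)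
    rw [dyadicCell]
    congr 1
    field_simp; ring
  calc ∫ y in dyadicCell n k, primitive g y ^ 2 ∂ν
      ≤ ∫ y in dyadicCell n k, (2 ^ n)⁻¹ * (∫ t in dyadicCell n k, g t ^ 2) ∂ν := by
        refine setIntegral_mono_on ?_ (integrable_const _) (measurableSet_dyadicCell n k) hpt
        simpa only [sq] using (integrable_primitive_mul ν g g).integrableOn
    _ = _ := by
        rw [setIntegral_const, smul_eq_mul]; ring

/-- Cells with $\nu(C)\Lambda(C)>t$ are halved until the Poincaré inequality has constant at most
`t`. Both halves again have a zero at the left endpoint: the left half inherits it, and the right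
half starts at the midpoint, where `hz` applies. -/
theorem integral_primitive_sq_le_of_vanishing {ν : Measure ℝ} [IsFiniteMeasure ν] {g : GradSpace}
    (hg : g ∈ meanZero) {t : ℝ} (ht : 0 < t)
    (hz : ∀ n k : ℕ, k < 2 ^ n → t * 2 ^ n < ν.real (dyadicCell n k) →
      primitive g ((2 * k + 1 : ℕ) / 2 ^ (n + 1)) = 0) {n k : ℕ} (hk : k < 2 ^ n)
    (h0 : primitive g (k / 2 ^ n) = 0) :
    ∫ y in dyadicCell n k, primitive g y ^ 2 ∂ν ≤ t * ∫ y in dyadicCell n k, g y ^ 2 := by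
  obtain ⟨N, hN⟩ := pow_unbounded_of_one_lt (ν.real univ / t) (one_lt_two (α := ℝ))
  rw [div_lt_iff₀ ht] at hN
  have hint : IntegrableOn (fun t => g t ^ 2) (Ioc 0 1) := by
    rw [integrableOn_Ioc_iff_integrableOn_Ioo]; exact (Lp.memLp g).integrable_sq
  have hcase : ∀ n k : ℕ, k < 2 ^ n → primitive g (k / 2 ^ n) = 0 →
      ν.real (dyadicCell n k) ≤ t * 2 ^ n →
      ∫ y in dyadicCell n k, primitive g y ^ 2 ∂ν ≤ t * ∫ y in dyadicCell n k, g y ^ 2 := by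
    intro n k hk h0 h
    refine (setIntegral_primitive_sq_le hg hk h0).trans ?_
    refine mul_le_mul_of_nonneg_right ?_ (integral_nonneg fun _ => sq_nonneg _)
    rwa [div_le_iff₀ (by positivity)]
  -- Induction on the number `j` of halvings left: from level `N` on every cell satisfies
  -- $\nu(C)\Lambda(C)\le t$.
  obtain ⟨j, hj⟩ : ∃ j, N ≤ n + j := ⟨N, by omega⟩
  induction j generalizing n k with
  | zero =>
    refine hcase n k hk h0 ((measureReal_mono (subset_univ _)).trans ?_)
    have : (2 : ℝ) ^ N ≤ 2 ^ n := pow_le_pow_right₀ (by norm_num) (by simpa using hj)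
    nlinarith
  | succ j ih =>
    rcases le_or_gt (ν.real (dyadicCell n k)) (t * 2 ^ n) with h | h
    · exact hcase n k hk h0 h
    · have hk1 : 2 * k < 2 ^ (n + 1) := by rw [pow_succ]; omega
      have hk2 : 2 * k + 1 < 2 ^ (n + 1) := by rw [pow_succ]; omega
      have hleft : ((2 * k : ℕ) : ℝ) / 2 ^ (n + 1) = k / 2 ^ n := by
        push_cast; rw [pow_succ]; field_simp
      have e1 := ih hk1 (by rw [hleft, h0]) (by omega)
      have e2 := ih hk2 (hz n k hk h) (by omega)
      have hd : Disjoint (dyadicCell (n + 1) (2 * k)) (dyadicCell (n + 1) (2 * k + 1)) :=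
        disjoint_dyadicCell (by omega)
      have hi : Integrable (fun y => primitive g y ^ 2) ν := by
        simpa only [sq] using integrable_primitive_mul ν g g
      rw [dyadicCell_eq_union, setIntegral_union hd (measurableSet_dyadicCell _ _)
        hi.integrableOn hi.integrableOn, setIntegral_union hd (measurableSet_dyadicCell _ _)
        (hint.mono_set (dyadicCell_subset hk1)) (hint.mono_set (dyadicCell_subset hk2)), mul_add]
      exact add_le_add e1 e2

/-- The number of eigenvalues up to `x` is at most the number of dyadic cells `C` with
`ν(C) Λ(C) > t`, for every `t < 1 / x`. -/
theorem eigenvalueCount_le_card {ν : Measure ℝ} [IsFiniteMeasure ν]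
    (hsupp : ν (Ioo (0 : ℝ) 1)ᶜ = 0) {x t : ℝ} (ht : 0 < t) (hxt : x * t < 1)
    (s : Finset (ℕ × ℕ))
    (hs : ∀ n k : ℕ, k < 2 ^ n → t * 2 ^ n < ν.real (dyadicCell n k) → (n, k) ∈ s) :
    eigenvalueCount ν x ≤ s.card := by
  -- Evaluation at the midpoints of the cells indexed by `s`. Injectivity on the span bounds its
  -- dimension by `s.card`.
  let L : (ℝ → ℝ) →ₗ[ℝ] (s → ℝ) :=
    LinearMap.pi fun p => LinearMap.proj (((2 * p.1.2 + 1 : ℕ) : ℝ) / 2 ^ (p.1.1 + 1))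
  let S := Submodule.span ℝ {f : ℝ → ℝ | ∃ l ≤ x, IsEigenfunction ν l f}
  have hinj : Function.Injective (L.domRestrict S) := by
    rw [← LinearMap.ker_eq_bot, LinearMap.ker_eq_bot']
    rintro ⟨f, hf⟩ hLf
    obtain ⟨g, hg, rfl, hle⟩ := exists_norm_sq_le_of_mem_span hf
    have hz : ∀ n k : ℕ, k < 2 ^ n → t * 2 ^ n < ν.real (dyadicCell n k) →
        primitive g ((2 * k + 1 : ℕ) / 2 ^ (n + 1)) = 0 := fun n k hk h =>
      congrFun hLf ⟨(n, k), hs n k hk h⟩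
    have h1 := integral_primitive_sq_le_of_vanishing hg ht hz (n := 0) (k := 0) (by simp)
      (primitive_eq_zero g (by simp))
    have hcell : dyadicCell 0 0 = Ioc 0 1 := by simp [dyadicCell]
    have hν : ν.restrict (Ioc (0 : ℝ) 1) = ν := by
      refine Measure.restrict_eq_self_of_ae_mem ?_
      rw [ae_iff]
      exact measure_mono_null (fun y hy h => hy (Ioo_subset_Ioc_self h)) hsupp
    have hnorm : ‖g‖ ^ 2 = ∫ y in Ioc (0 : ℝ) 1, g y ^ 2 := by
      rw [← real_inner_self_eq_norm_sq, L2.inner_def, integral_Ioc_eq_integral_Ioo]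
      refine integral_congr_ae (ae_of_all _ fun y => ?_)
      simp [sq]
    rw [hcell, hν, ← hnorm] at h1
    simp only [← sq] at hle
    -- For positive `x` the two estimates combine to $\|g\|^2\le xt\|g\|^2$ with $xt<1$.
    have hg0 : g = 0 := by
      by_contra hne
      have hpos : 0 < ‖g‖ ^ 2 := by positivity
      have hint : 0 ≤ ∫ y, primitive g y ^ 2 ∂ν := integral_nonneg fun _ => sq_nonneg _
      rcases le_or_gt x 0 with hx | hx
      · nlinarith
      · nlinarith [mul_le_mul_of_nonneg_left h1 hx.le]
    exact Subtype.ext (by simp [hg0])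
  have hrank := LinearMap.rank_le_of_injective (L.domRestrict S) hinj
  have hcount := Cardinal.toENat.monotone' hrank
  rw [eigenvalueCount]
  simpa using hcount

/-! ### Dyadic power sums and the $L^q$-spectrum. -/

open Classical in
/-- The indices of the dyadic cells of level `n` with positive measure. -/
def posCells (ν : Measure ℝ) (n : ℕ) : Finset ℕ :=
  (Finset.range (2 ^ n)).filter fun k => 0 < ν (dyadicCell n k)

/-- The sum of the `q`-th powers of the measures of the dyadic cells of level `n`. -/
def powSum (ν : Measure ℝ) (n : ℕ) (q : ℝ) : ℝ :=
  ∑ k ∈ posCells ν n, ν.real (dyadicCell n k) ^ q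

theorem lqSpectrumAt_eq (ν : Measure ℝ) (n : ℕ) (q : ℝ) :
    lqSpectrumAt ν n q = 1 / Real.log ((2 : ℝ) ^ n) * Real.log (powSum ν n q) := rfl

/-- `∑ ν(C)^q` grows at most like `2^(n c)`. -/
def HasGrowth (ν : Measure ℝ) (q c : ℝ) : Prop :=
  ∃ A > 0, ∀ n : ℕ, powSum ν n q ≤ A * (2 : ℝ) ^ ((n : ℝ) * c)

theorem mem_posCells {ν : Measure ℝ} {n k : ℕ} :
    k ∈ posCells ν n ↔ k < 2 ^ n ∧ 0 < ν (dyadicCell n k) := by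
  simp [posCells]

theorem pos_of_mem_posCells {ν : Measure ℝ} [IsFiniteMeasure ν] {n k : ℕ} (hk : k ∈ posCells ν n) :
    0 < ν.real (dyadicCell n k) := by
  rw [measureReal_def]
  exact ENNReal.toReal_pos (mem_posCells.1 hk).2.ne' (measure_ne_top _ _)

theorem iUnion_dyadicCell (n : ℕ) :
    ⋃ k ∈ Finset.range (2 ^ n), dyadicCell n k = Ioc 0 1 := by
  refine Subset.antisymm (iUnion₂_subset fun k hk => dyadicCell_subset (Finset.mem_range.1 hk)) ?_
  intro y hy
  have h2 : (0 : ℝ) < 2 ^ n := by positivity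
  have hpos : 0 < ⌈y * 2 ^ n⌉₊ := Nat.ceil_pos.2 (mul_pos hy.1 h2)
  have hlt := Nat.ceil_lt_add_one (mul_pos hy.1 h2).le
  have hle := Nat.le_ceil (y * 2 ^ n)
  have hmax : ⌈y * 2 ^ n⌉₊ ≤ 2 ^ n := by
    refine Nat.ceil_le.2 ?_
    push_cast
    nlinarith [hy.2]
  have hcast : ((⌈y * 2 ^ n⌉₊ - 1 : ℕ) : ℝ) = (⌈y * 2 ^ n⌉₊ : ℝ) - 1 := by
    rw [Nat.cast_sub hpos]; simp
  simp only [mem_iUnion, Finset.mem_range]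
  refine ⟨⌈y * 2 ^ n⌉₊ - 1, by omega, ?_, ?_⟩
  · rw [hcast, div_lt_iff₀ h2]; linarith
  · rw [hcast, le_div_iff₀ h2]; linarith

section Finite

variable {ν : Measure ℝ} [IsFiniteMeasure ν]

omit [IsFiniteMeasure ν] in
theorem measureReal_univ_eq (hsupp : ν (Ioo (0 : ℝ) 1)ᶜ = 0) :
    ν.real univ = ν.real (Ioc 0 1) := by
  refine measureReal_congr ?_
  refine (eventuallyEq_univ.2 ?_).symm
  rw [mem_ae_iff]
  exact measure_mono_null (compl_subset_compl.2 Ioo_subset_Ioc_self) hsupp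

theorem powSum_one (hsupp : ν (Ioo (0 : ℝ) 1)ᶜ = 0) (n : ℕ) : powSum ν n 1 = ν.real univ := by
  rw [measureReal_univ_eq hsupp, ← iUnion_dyadicCell n, measureReal_biUnion_finset
    (fun i _ j _ hij => disjoint_dyadicCell hij) (fun k _ => measurableSet_dyadicCell n k), powSum]
  simp only [Real.rpow_one]
  refine Finset.sum_subset (fun k hk => Finset.mem_range.2 (mem_posCells.1 hk).1) ?_
  intro k hk hk'
  rw [mem_posCells, not_and, not_lt, nonpos_iff_eq_zero] at hk'
  rw [measureReal_def, hk' (Finset.mem_range.1 hk)]; rfl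

theorem measureReal_univ_pos (hν : ν ≠ 0) : 0 < ν.real univ := by
  have : NeZero ν := ⟨hν⟩
  exact MeasureTheory.measureReal_univ_pos

theorem posCells_nonempty (hν : ν ≠ 0) (hsupp : ν (Ioo (0 : ℝ) 1)ᶜ = 0) (n : ℕ) :
    (posCells ν n).Nonempty := by
  by_contra h
  have h1 := powSum_one hsupp n
  rw [powSum, Finset.not_nonempty_iff_eq_empty.1 h, Finset.sum_empty] at h1
  exact (measureReal_univ_pos hν).ne h1

theorem powSum_pos (hν : ν ≠ 0) (hsupp : ν (Ioo (0 : ℝ) 1)ᶜ = 0) (n : ℕ) (q : ℝ) :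
    0 < powSum ν n q :=
  Finset.sum_pos (fun _ hk => Real.rpow_pos_of_pos (pos_of_mem_posCells hk) _)
    (posCells_nonempty hν hsupp n)

omit [IsFiniteMeasure ν] in
theorem hasGrowth_of_eventually {q c K : ℝ} (hK : 0 < K)
    (h : ∀ᶠ n : ℕ in atTop, powSum ν n q ≤ K * (2 : ℝ) ^ ((n : ℝ) * c)) : HasGrowth ν q c := by
  obtain ⟨N, hN⟩ := eventually_atTop.1 h
  have hnn : ∀ n, 0 ≤ powSum ν n q * (2 : ℝ) ^ (-((n : ℝ) * c)) := fun n =>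
    mul_nonneg (Finset.sum_nonneg fun _ _ => Real.rpow_nonneg measureReal_nonneg _) (by positivity)
  have hs := Finset.sum_nonneg fun n (_ : n ∈ Finset.range N) => hnn n
  refine ⟨K + ∑ n ∈ Finset.range N, powSum ν n q * (2 : ℝ) ^ (-((n : ℝ) * c)), by linarith,
    fun n => ?_⟩
  have hp : (0 : ℝ) < (2 : ℝ) ^ ((n : ℝ) * c) := by positivity
  rcases le_or_gt N n with hn | hn
  · exact (hN n hn).trans (mul_le_mul_of_nonneg_right (by linarith) hp.le)
  · have h1 := Finset.single_le_sum (fun n _ => hnn n) (Finset.mem_range.2 hn)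
    rw [Real.rpow_neg zero_le_two, ← div_eq_mul_inv, div_le_iff₀ hp] at h1
    nlinarith

/-- With `HasGrowth.lqSpectrum_le` this makes the spectrum at `q` the infimum of the growth
exponents, so later arguments can use bounds valid for all `n` instead of a limsup. -/
theorem hasGrowth_of_lt (hν : ν ≠ 0) (hsupp : ν (Ioo (0 : ℝ) 1)ᶜ = 0) {q c : ℝ}
    (h : lqSpectrum ν q < (c : EReal)) : HasGrowth ν q c := by
  refine hasGrowth_of_eventually one_pos ?_
  filter_upwards [eventually_lt_of_limsup_lt h, eventually_gt_atTop 0] with n hn hn0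
  rw [EReal.coe_lt_coe_iff, lqSpectrumAt_eq, one_div, inv_mul_lt_iff₀
    (Real.log_pos (one_lt_pow₀ one_lt_two hn0.ne')), Real.log_pow] at hn
  rw [one_mul, ← Real.log_le_log_iff (powSum_pos hν hsupp n q) (by positivity), Real.log_rpow two_pos]
  linarith

theorem HasGrowth.lqSpectrum_le (hν : ν ≠ 0) (hsupp : ν (Ioo (0 : ℝ) 1)ᶜ = 0) {q c : ℝ}
    (h : HasGrowth ν q c) : lqSpectrum ν q ≤ (c : EReal) := by
  obtain ⟨A, hA, h⟩ := h
  have hlim : Tendsto (fun n : ℕ => (((c + Real.log A / Real.log 2 / n : ℝ)) : EReal)) atTop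
      (𝓝 (c : EReal)) := by
    refine continuous_coe_real_ereal.continuousAt.tendsto.comp ?_
    simpa using (tendsto_const_nhds (x := c)).add
      (tendsto_const_div_atTop_nhds_zero_nat (Real.log A / Real.log 2))
  rw [← hlim.limsup_eq]
  refine limsup_le_limsup ?_
  filter_upwards [eventually_gt_atTop 0] with n hn0
  have hn : (0 : ℝ) < n := by exact_mod_cast hn0
  have h2 : 0 < Real.log 2 := Real.log_pos one_lt_two
  rw [EReal.coe_le_coe_iff, lqSpectrumAt_eq, one_div, inv_mul_le_iff₀
    (Real.log_pos (one_lt_pow₀ one_lt_two hn0.ne')), Real.log_pow]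
  have h1 := Real.log_le_log (powSum_pos hν hsupp n q) (h n)
  rw [Real.log_mul hA.ne' (by positivity), Real.log_rpow two_pos] at h1
  refine h1.trans (le_of_eq ?_)
  field_simp
  ring

omit [IsFiniteMeasure ν] in
theorem HasGrowth.mono {q c c' : ℝ} (h : HasGrowth ν q c) (hc : c ≤ c') : HasGrowth ν q c' := by
  obtain ⟨A, hA, h⟩ := h
  refine ⟨A, hA, fun n => (h n).trans ?_⟩
  gcongr
  norm_num

/-- Hölder's inequality with exponents `a⁻¹` and `b⁻¹`. It is the source of the convexity of the
spectrum. -/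
theorem powSum_le_rpow_mul_rpow (n : ℕ) {q₀ q₁ a b : ℝ} (ha : 0 < a) (hb : 0 < b)
    (hab : a + b = 1) :
    powSum ν n (a * q₀ + b * q₁) ≤ powSum ν n q₀ ^ a * powSum ν n q₁ ^ b := by
  have hconj : (a⁻¹).HolderConjugate b⁻¹ := by
    rw [Real.holderConjugate_iff]
    refine ⟨(one_lt_inv₀ ha).2 (by linarith), ?_⟩
    rw [inv_inv, inv_inv, hab]
  have h := Real.inner_le_Lp_mul_Lq_of_nonneg (posCells ν n) hconj
    (f := fun k => ν.real (dyadicCell n k) ^ (a * q₀))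
    (g := fun k => ν.real (dyadicCell n k) ^ (b * q₁))
    (fun _ _ => Real.rpow_nonneg measureReal_nonneg _)
    (fun _ _ => Real.rpow_nonneg measureReal_nonneg _)
  simp only [one_div, inv_inv] at h
  rw [powSum, powSum, powSum]
  convert h using 1
  · exact Finset.sum_congr rfl fun k hk => Real.rpow_add (pos_of_mem_posCells hk) _ _
  · congr 2
    · refine Finset.sum_congr rfl fun k hk => ?_
      rw [← Real.rpow_mul measureReal_nonneg]; congr 1; field_simp
    · refine Finset.sum_congr rfl fun k hk => ?_
      rw [← Real.rpow_mul measureReal_nonneg]; congr 1; field_simp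

omit [IsFiniteMeasure ν] in
theorem powSum_nonneg (n : ℕ) (q : ℝ) : 0 ≤ powSum ν n q :=
  Finset.sum_nonneg fun _ _ => Real.rpow_nonneg measureReal_nonneg _

theorem HasGrowth.convex {q₀ q₁ c₀ c₁ a b : ℝ} (h₀ : HasGrowth ν q₀ c₀) (h₁ : HasGrowth ν q₁ c₁)
    (ha : 0 < a) (hb : 0 < b) (hab : a + b = 1) :
    HasGrowth ν (a * q₀ + b * q₁) (a * c₀ + b * c₁) := by
  obtain ⟨A, hA, h₀⟩ := h₀
  obtain ⟨B, hB, h₁⟩ := h₁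
  refine ⟨A ^ a * B ^ b, by positivity, fun n => ?_⟩
  calc powSum ν n (a * q₀ + b * q₁) ≤ powSum ν n q₀ ^ a * powSum ν n q₁ ^ b :=
        powSum_le_rpow_mul_rpow n ha hb hab
    _ ≤ (A * (2 : ℝ) ^ ((n : ℝ) * c₀)) ^ a * (B * (2 : ℝ) ^ ((n : ℝ) * c₁)) ^ b := by
        have := powSum_nonneg (ν := ν) n q₀
        have := powSum_nonneg (ν := ν) n q₁
        gcongr
        · exact h₀ n
        · exact h₁ n
    _ = _ := by
        rw [Real.mul_rpow hA.le (by positivity), Real.mul_rpow hB.le (by positivity),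
          ← Real.rpow_mul zero_le_two, ← Real.rpow_mul zero_le_two, mul_add,
          Real.rpow_add two_pos, show (n : ℝ) * (a * c₀) = n * c₀ * a by ring,
          show (n : ℝ) * (b * c₁) = n * c₁ * b by ring]
        ring

omit [IsFiniteMeasure ν] in
theorem hasGrowth_zero_one : HasGrowth ν 0 1 := by
  refine ⟨1, one_pos, fun n => ?_⟩
  simp only [powSum, Real.rpow_zero, Finset.sum_const, nsmul_eq_mul, mul_one, one_mul,
    Real.rpow_natCast]
  have : (posCells ν n).card ≤ 2 ^ n := by
    refine (Finset.card_le_card (fun k hk => Finset.mem_range.2 (mem_posCells.1 hk).1)).trans ?_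
    rw [Finset.card_range]
  exact_mod_cast this

theorem hasGrowth_one_zero (hν : ν ≠ 0) (hsupp : ν (Ioo (0 : ℝ) 1)ᶜ = 0) : HasGrowth ν 1 0 :=
  ⟨ν.real univ, measureReal_univ_pos hν, fun n => by rw [powSum_one hsupp]; simp⟩

/-- At exponent 1 the power sum is the positive constant `ν.real univ`, which cannot decay. -/
theorem HasGrowth.nonneg_of_one (hν : ν ≠ 0) (hsupp : ν (Ioo (0 : ℝ) 1)ᶜ = 0) {c : ℝ}
    (h : HasGrowth ν 1 c) : 0 ≤ c := by
  by_contra! hc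
  obtain ⟨A, hA, h⟩ := h
  have h0 : Tendsto (fun n : ℕ => A * (2 : ℝ) ^ ((n : ℝ) * c)) atTop (𝓝 (A * 0)) := by
    refine Tendsto.const_mul _ ?_
    have := tendsto_pow_atTop_nhds_zero_of_lt_one (r := (2 : ℝ) ^ c) (by positivity)
      (Real.rpow_lt_one_of_one_lt_of_neg one_lt_two hc)
    refine this.congr fun n => ?_
    rw [← Real.rpow_natCast, ← Real.rpow_mul zero_le_two, mul_comm]
  rw [mul_zero] at h0
  refine absurd (ge_of_tendsto' h0 fun n => ?_) (not_le.2 (measureReal_univ_pos hν))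
  rw [← powSum_one hsupp n]; exact h n

theorem hasGrowth_of_one_le (hν : ν ≠ 0) (hsupp : ν (Ioo (0 : ℝ) 1)ᶜ = 0) {q : ℝ} (hq : 1 ≤ q) :
    HasGrowth ν q 0 := by
  have hM := measureReal_univ_pos hν
  refine ⟨ν.real univ ^ (q - 1) * ν.real univ, by positivity, fun n => ?_⟩
  rw [mul_zero, Real.rpow_zero, mul_one, ← powSum_one hsupp n, powSum, powSum, Finset.mul_sum]
  refine Finset.sum_le_sum fun k hk => ?_
  have hpos := pos_of_mem_posCells hk
  rw [show ν.real (dyadicCell n k) ^ q = ν.real (dyadicCell n k) ^ (q - 1) *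
    ν.real (dyadicCell n k) ^ (1 : ℝ) by rw [← Real.rpow_add hpos]; congr 1; ring]
  refine mul_le_mul_of_nonneg_right ?_ (by positivity)
  have h1 : powSum ν n 1 = ν.real univ := powSum_one hsupp n
  rw [powSum] at h1
  rw [h1]
  exact Real.rpow_le_rpow hpos.le (measureReal_mono (subset_univ _)) (by linarith)

theorem hasGrowth_of_le_one (hν : ν ≠ 0) (hsupp : ν (Ioo (0 : ℝ) 1)ᶜ = 0) {q : ℝ} (h0 : 0 ≤ q)
    (h1 : q ≤ 1) : HasGrowth ν q (1 - q) := by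
  rcases eq_or_lt_of_le h0 with rfl | h0
  · simpa using hasGrowth_zero_one
  rcases eq_or_lt_of_le h1 with rfl | h1
  · simpa using hasGrowth_one_zero hν hsupp
  have := (hasGrowth_zero_one (ν := ν)).convex (hasGrowth_one_zero hν hsupp) (sub_pos.2 h1) h0
    (by ring)
  simpa using this

/-- Interpolate 1 between `q` and 2: the growth exponent 0 is admissible at 2, so a negative one at
`q` would give a negative one at 1. -/
theorem HasGrowth.nonneg_of_le_one (hν : ν ≠ 0) (hsupp : ν (Ioo (0 : ℝ) 1)ᶜ = 0) {q c : ℝ}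
    (hq : q ≤ 1) (h : HasGrowth ν q c) : 0 ≤ c := by
  have hq2 : 0 < 2 - q := by linarith
  rcases eq_or_lt_of_le hq with rfl | hq
  · exact h.nonneg_of_one hν hsupp
  have := h.convex (hasGrowth_of_one_le hν hsupp one_le_two) (a := 1 / (2 - q))
    (b := (1 - q) / (2 - q)) (by positivity) (div_pos (by linarith) hq2) (by field_simp; ring)
  rw [show 1 / (2 - q) * q + (1 - q) / (2 - q) * 2 = 1 by field_simp; ring, mul_zero,
    add_zero] at this
  exact nonneg_of_mul_nonneg_right (this.nonneg_of_one hν hsupp) (by positivity)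

/-- The same device with 1 between 0 and `q`, using the growth exponent 1 at 0. These lower bounds
keep `lqSpectrum` away from `⊥`. -/
theorem HasGrowth.one_sub_le (hν : ν ≠ 0) (hsupp : ν (Ioo (0 : ℝ) 1)ᶜ = 0) {q c : ℝ}
    (hq : 1 ≤ q) (h : HasGrowth ν q c) : 1 - q ≤ c := by
  rcases eq_or_lt_of_le hq with rfl | hq
  · simpa using h.nonneg_of_one hν hsupp
  have hq0 : 0 < q := by linarith
  have := h.convex (hasGrowth_zero_one (ν := ν)) (a := 1 / q) (b := (q - 1) / q) (by positivity)
    (div_pos (by linarith) hq0) (by field_simp; ring)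
  rw [show 1 / q * q + (q - 1) / q * 0 = 1 by field_simp; ring] at this
  have h2 := this.nonneg_of_one hν hsupp
  have h3 : 1 / q * c + (q - 1) / q * 1 = (c + (q - 1)) / q := by ring
  rw [h3] at h2
  have := mul_nonneg h2 hq0.le
  rw [div_mul_cancel₀ _ hq0.ne'] at this
  linarith

/-- The `L^q`-spectrum as a real function. -/
def lqReal (ν : Measure ℝ) (q : ℝ) : ℝ := (lqSpectrum ν q).toReal

theorem le_lqSpectrum (hν : ν ≠ 0) (hsupp : ν (Ioo (0 : ℝ) 1)ᶜ = 0) {q b : ℝ}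
    (h : ∀ c, HasGrowth ν q c → b ≤ c) : (b : EReal) ≤ lqSpectrum ν q := by
  by_contra! hlt
  obtain ⟨c, h1, h2⟩ := EReal.lt_iff_exists_real_btwn.1 hlt
  exact absurd (h c (hasGrowth_of_lt hν hsupp h1)) (not_le.2 (EReal.coe_lt_coe_iff.1 h2))

theorem coe_lqReal (hν : ν ≠ 0) (hsupp : ν (Ioo (0 : ℝ) 1)ᶜ = 0) {q : ℝ} (hq : 0 ≤ q) :
    (lqReal ν q : EReal) = lqSpectrum ν q := by
  refine EReal.coe_toReal ?_ ?_
  · rcases le_total q 1 with h | h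
    · exact ne_top_of_le_ne_top (EReal.coe_ne_top _)
        ((hasGrowth_of_le_one hν hsupp hq h).lqSpectrum_le hν hsupp)
    · exact ne_top_of_le_ne_top (EReal.coe_ne_top _)
        ((hasGrowth_of_one_le hν hsupp h).lqSpectrum_le hν hsupp)
  · rcases le_total q 1 with h | h
    · exact ne_bot_of_le_ne_bot (EReal.coe_ne_bot _)
        (le_lqSpectrum hν hsupp fun c hc => hc.nonneg_of_le_one hν hsupp h)
    · exact ne_bot_of_le_ne_bot (EReal.coe_ne_bot _)
        (le_lqSpectrum hν hsupp fun c hc => hc.one_sub_le hν hsupp h)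

theorem hasGrowth_of_lqReal_lt (hν : ν ≠ 0) (hsupp : ν (Ioo (0 : ℝ) 1)ᶜ = 0) {q c : ℝ}
    (hq : 0 ≤ q) (h : lqReal ν q < c) : HasGrowth ν q c :=
  hasGrowth_of_lt hν hsupp (by rw [← coe_lqReal hν hsupp hq]; exact EReal.coe_lt_coe_iff.2 h)

theorem HasGrowth.lqReal_le (hν : ν ≠ 0) (hsupp : ν (Ioo (0 : ℝ) 1)ᶜ = 0) {q c : ℝ}
    (hq : 0 ≤ q) (h : HasGrowth ν q c) : lqReal ν q ≤ c := by
  have := h.lqSpectrum_le hν hsupp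
  rwa [← coe_lqReal hν hsupp hq, EReal.coe_le_coe_iff] at this

theorem le_lqReal (hν : ν ≠ 0) (hsupp : ν (Ioo (0 : ℝ) 1)ᶜ = 0) {q b : ℝ} (hq : 0 ≤ q)
    (h : ∀ c, HasGrowth ν q c → b ≤ c) : b ≤ lqReal ν q := by
  have := le_lqSpectrum hν hsupp h
  rwa [← coe_lqReal hν hsupp hq, EReal.coe_le_coe_iff] at this

theorem lqReal_one (hν : ν ≠ 0) (hsupp : ν (Ioo (0 : ℝ) 1)ᶜ = 0) : lqReal ν 1 = 0 :=
  le_antisymm ((hasGrowth_one_zero hν hsupp).lqReal_le hν hsupp zero_le_one)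
    (le_lqReal hν hsupp zero_le_one fun _ hc => hc.nonneg_of_one hν hsupp)

theorem convexOn_lqReal (hν : ν ≠ 0) (hsupp : ν (Ioo (0 : ℝ) 1)ᶜ = 0) :
    ConvexOn ℝ (Ici 0) (lqReal ν) := by
  rw [convexOn_iff_forall_pos]
  refine ⟨convex_Ici 0, fun q₀ h₀ q₁ h₁ a b ha hb hab => ?_⟩
  simp only [smul_eq_mul]
  refine le_of_forall_pos_le_add fun ε hε => ?_
  have h := (hasGrowth_of_lqReal_lt hν hsupp h₀ (lt_add_of_pos_right _ hε)).convex
    (hasGrowth_of_lqReal_lt hν hsupp h₁ (lt_add_of_pos_right _ hε)) ha hb hab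
  have hq : 0 ≤ a * q₀ + b * q₁ :=
    add_nonneg (mul_nonneg ha.le h₀) (mul_nonneg hb.le h₁)
  refine (h.lqReal_le hν hsupp hq).trans (le_of_eq ?_)
  linear_combination ε * hab

end Finite

theorem log_toENNReal_div {m : ℕ} (hm : 0 < m) (y : ℝ) :
    ENNReal.log (((m : ℕ∞) : ℝ≥0∞)) / (y : EReal) = ((Real.log m / y : ℝ) : EReal) := by
  have hm' : (0 : ℝ) < m := by exact_mod_cast hm
  rw [EReal.coe_div, ← ENNReal.log_ofReal_of_pos hm', ENNReal.ofReal_natCast, ENat.toENNReal_coe]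

/-! ### The Minkowski dimension of the support as $\beta_\nu(0)$. -/

section Covering

variable {ν : Measure ℝ}

theorem support_subset_Icc (hsupp : ν (Ioo (0 : ℝ) 1)ᶜ = 0) : ν.support ⊆ Icc 0 1 :=
  Measure.support_subset_of_isClosed isClosed_Icc
    (mem_ae_iff.2 (measure_mono_null (compl_subset_compl.2 Ioo_subset_Icc_self) hsupp))

/-- The point `x` itself may lie in no cell (if `x = 0`) or at the right end of a null cell, so one
only gets a positive cell arbitrarily close to it. -/
theorem exists_posCells_inter_ball (hsupp : ν (Ioo (0 : ℝ) 1)ᶜ = 0) (n : ℕ) {x ε : ℝ} (hε : 0 < ε)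
    (hx : x ∈ ν.support) : ∃ k ∈ posCells ν n, (dyadicCell n k ∩ Metric.ball x ε).Nonempty := by
  by_contra! h
  have hpos := (Measure.mem_support_iff_forall x).1 hx _ (Metric.ball_mem_nhds x hε)
  refine hpos.ne' (measure_mono_null (t := (Ioo (0 : ℝ) 1)ᶜ ∪
    ⋃ k ∈ Finset.range (2 ^ n), (dyadicCell n k ∩ Metric.ball x ε)) ?_ ?_)
  · intro y hy
    by_cases hy1 : y ∈ Ioo (0 : ℝ) 1
    · have hy2 := Ioo_subset_Ioc_self hy1
      rw [← iUnion_dyadicCell n, mem_iUnion₂] at hy2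
      obtain ⟨k, hk, hyk⟩ := hy2
      exact Or.inr (mem_iUnion₂.2 ⟨k, hk, hyk, hy⟩)
    · exact Or.inl hy1
  · refine measure_union_null hsupp ((measure_biUnion_null_iff (Finset.countable_toSet _)).2 ?_)
    intro k hk
    by_cases hk' : k ∈ posCells ν n
    · rw [h k hk', measure_empty]
    · rw [mem_posCells, not_and, not_lt, nonpos_iff_eq_zero] at hk'
      exact measure_mono_null inter_subset_left (hk' (Finset.mem_range.1 hk))

theorem abs_sub_le_of_mem_dyadicCell {n k : ℕ} {x y : ℝ} (hx : x ∈ dyadicCell n k)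
    (hy : y ∈ dyadicCell n k) : |x - y| ≤ (2 ^ n)⁻¹ := by
  have h1 : ((k : ℝ) + 1) / 2 ^ n = k / 2 ^ n + (2 ^ n)⁻¹ := by ring
  rw [dyadicCell, h1] at hx hy
  rw [abs_le]
  constructor <;> linarith [hx.1, hx.2, hy.1, hy.2]

/-- One support point is chosen in each positive cell. The factor 2 pays once for the distance to
the cell and once for the diameter of the cell. -/
theorem coveringNumber_le_card_posCells (hsupp : ν (Ioo (0 : ℝ) 1)ᶜ = 0) (n : ℕ) {ε : ℝ}
    (hε : 2 * (2 ^ n)⁻¹ ≤ ε) :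
    Metric.coveringNumber ε.toNNReal ν.support ≤ (posCells ν n).card := by
  classical
  have hp : ∀ k ∈ posCells ν n, (dyadicCell n k ∩ ν.support).Nonempty := fun k hk =>
    Measure.nonempty_inter_support_of_pos (mem_posCells.1 hk).2
  choose! p hp using hp
  have hsub : ((posCells ν n).image p : Set ℝ) ⊆ ν.support := by
    intro y hy
    obtain ⟨k, hk, rfl⟩ := Finset.mem_image.1 (Finset.mem_coe.1 hy)
    exact (hp k hk).2
  have hcov : Metric.IsCover ε.toNNReal ν.support ((posCells ν n).image p : Set ℝ) := by
    rw [Metric.isCover_iff_subset_iUnion_closedBall]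
    intro x hx
    obtain ⟨k, hk, z, hz, hzx⟩ := exists_posCells_inter_ball hsupp n
      (ε := (2 ^ n)⁻¹) (by positivity) hx
    refine mem_iUnion₂.2 ⟨p k, Finset.mem_coe.2 (Finset.mem_image_of_mem p hk), ?_⟩
    have hε0 : 0 ≤ ε := le_trans (by positivity) hε
    rw [Real.coe_toNNReal _ hε0, Metric.mem_closedBall]
    have h1 := abs_sub_le_of_mem_dyadicCell hz (hp k hk).1
    rw [← Real.dist_eq] at h1
    rw [Metric.mem_ball, dist_comm] at hzx
    linarith [dist_triangle x z (p k)]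
  refine (hcov.coveringNumber_le_encard hsub).trans ?_
  rw [Set.encard_coe_eq_coe_finsetCard]
  exact_mod_cast Finset.card_image_le

/-- A closed ball of radius $2^{-n}$ meets at most three half-open cells of level `n`. -/
theorem card_posCells_le_coveringNumber (hsupp : ν (Ioo (0 : ℝ) 1)ᶜ = 0) (n : ℕ) {m : ℕ}
    (hm : Metric.coveringNumber ((2 : ℝ) ^ n)⁻¹.toNNReal ν.support = m) :
    (posCells ν n).card ≤ 3 * m := by
  classical
  obtain ⟨C, hCsub, hCfin, hCcov, hCcard⟩ := Metric.exists_set_encard_eq_coveringNumber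
    (ε := ((2 : ℝ) ^ n)⁻¹.toNNReal) (A := ν.support) (by rw [hm]; exact ENat.natCast_ne_top _)
  rw [hm] at hCcard
  rw [Metric.isCover_iff_subset_iUnion_closedBall] at hCcov
  have hcard : hCfin.toFinset.card = m := by
    have := hCfin.encard_eq_coe_toFinset_card
    rw [hCcard] at this
    exact_mod_cast this.symm
  have hsub : posCells ν n ⊆ hCfin.toFinset.biUnion fun c =>
      Finset.Icc (⌈c * 2 ^ n⌉₊ - 2) ⌈c * 2 ^ n⌉₊ := by
    intro k hk
    obtain ⟨y, hy, hys⟩ := Measure.nonempty_inter_support_of_pos (mem_posCells.1 hk).2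
    obtain ⟨c, hc, hyc⟩ := mem_iUnion₂.1 (hCcov hys)
    rw [Real.coe_toNNReal _ (by positivity), Metric.mem_closedBall, Real.dist_eq, abs_le] at hyc
    have hc0 := (support_subset_Icc hsupp (hCsub hc)).1
    have h2 : (0 : ℝ) < 2 ^ n := by positivity
    have hy1 : (k : ℝ) / 2 ^ n < y := hy.1
    have hy2 : y ≤ ((k : ℝ) + 1) / 2 ^ n := hy.2
    rw [div_lt_iff₀ h2] at hy1
    rw [le_div_iff₀ h2] at hy2
    have hinv : ((2 : ℝ) ^ n)⁻¹ * 2 ^ n = 1 := inv_mul_cancel₀ h2.ne'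
    have h3 := mul_le_mul_of_nonneg_right hyc.1 h2.le
    have h4 := mul_le_mul_of_nonneg_right hyc.2 h2.le
    refine Finset.mem_biUnion.2 ⟨c, hCfin.mem_toFinset.2 hc, Finset.mem_Icc.2 ⟨?_, ?_⟩⟩
    · have : ⌈c * 2 ^ n⌉₊ ≤ k + 2 := by
        refine Nat.ceil_le.2 ?_
        push_cast
        nlinarith
      omega
    · have h5 := Nat.le_ceil (c * 2 ^ n)
      have : (k : ℝ) < (⌈c * 2 ^ n⌉₊ : ℝ) + 1 := by nlinarith
      have : k < ⌈c * 2 ^ n⌉₊ + 1 := by exact_mod_cast this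
      omega
  refine (Finset.card_le_card hsub).trans (Finset.card_biUnion_le.trans ?_)
  rw [← hcard, mul_comm, ← smul_eq_mul, ← Finset.sum_const]
  refine Finset.sum_le_sum fun c _ => ?_
  rw [Nat.card_Icc]; omega

theorem powSum_zero (n : ℕ) : powSum ν n 0 = (posCells ν n).card := by
  simp [powSum]

theorem upperMinkowskiDim_support [IsFiniteMeasure ν] (hν : ν ≠ 0) (hsupp : ν (Ioo (0 : ℝ) 1)ᶜ = 0) :
    upperMinkowskiDim ν.support = (lqReal ν 0 : EReal) := by
  have hne : ν.support.Nonempty := by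
    rw [Set.nonempty_iff_ne_empty]
    intro h
    have := Measure.measure_compl_support (μ := ν)
    rw [h, compl_empty, Measure.measure_univ_eq_zero] at this
    exact hν this
  have hnum : ∀ ε : ℝ, 0 < ε → ∃ m : ℕ, 0 < m ∧
      Metric.coveringNumber ε.toNNReal ν.support = m := by
    intro ε hε
    obtain ⟨n, hn⟩ := exists_pow_lt_of_lt_one (half_pos hε) (y := (2 : ℝ)⁻¹) (by norm_num)
    rw [inv_pow] at hn
    have h1 := coveringNumber_le_card_posCells hsupp n (ε := ε) (by linarith)
    obtain ⟨m, hm⟩ := ENat.ne_top_iff_exists.1 (ne_top_of_le_ne_top (ENat.natCast_ne_top _) h1)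
    refine ⟨m, ?_, hm.symm⟩
    have h2 := (Metric.coveringNumber_pos_iff (ε := ε.toNNReal)).2 hne
    rw [← hm] at h2
    exact_mod_cast h2
  refine le_antisymm ?_ ?_
  · refine EReal.le_of_forall_lt_iff_le.1 fun c hc => ?_
    have hc' : lqReal ν 0 < c := EReal.coe_lt_coe_iff.1 hc
    have hgrow := hasGrowth_of_lqReal_lt hν hsupp le_rfl hc'
    have hc0 : 0 ≤ c := hgrow.nonneg_of_le_one hν hsupp zero_le_one
    obtain ⟨A, hA, hgrow⟩ := hgrow
    have hlim : Tendsto (fun ε : ℝ => ((c + Real.log (A * 4 ^ c) / (-Real.log ε) : ℝ) : EReal))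
        (𝓝[>] 0) (𝓝 (c : EReal)) := by
      refine continuous_coe_real_ereal.continuousAt.tendsto.comp ?_
      have h1 : Tendsto (fun ε : ℝ => -Real.log ε) (𝓝[>] 0) atTop :=
        tendsto_neg_atBot_atTop.comp Real.tendsto_log_nhdsGT_zero
      simpa using (tendsto_const_nhds (x := c)).add (h1.const_div_atTop (Real.log (A * 4 ^ c)))
    rw [← hlim.limsup_eq, upperMinkowskiDim]
    refine limsup_le_limsup ?_
    filter_upwards [Ioo_mem_nhdsGT (zero_lt_one' ℝ)] with ε hε
    obtain ⟨m, hm0, hm⟩ := hnum ε hε.1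
    rw [hm, log_toENNReal_div hm0, EReal.coe_le_coe_iff]
    -- A level fine enough for the covering bound yet with $2^n\le4/\varepsilon$, whence the
    -- constant `4 ^ c` above.
    obtain ⟨n, hn1, hn2⟩ : ∃ n : ℕ, 2 * ((2 : ℝ) ^ n)⁻¹ ≤ ε ∧ (2 : ℝ) ^ n ≤ 4 / ε := by
      obtain ⟨n, h1, h2⟩ := exists_nat_pow_near (x := 2 / ε) (y := (2 : ℝ))
        (by rw [one_le_div hε.1]; linarith [hε.2]) one_lt_two
      refine ⟨n + 1, ?_, ?_⟩
      · rw [div_lt_iff₀ hε.1] at h2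
        rw [← div_eq_mul_inv, div_le_iff₀ (by positivity)]
        linarith
      · rw [pow_succ]
        calc (2 : ℝ) ^ n * 2 ≤ 2 / ε * 2 := by gcongr
          _ = 4 / ε := by ring
    have h1 := coveringNumber_le_card_posCells hsupp n hn1
    rw [hm] at h1
    have h2 : (m : ℝ) ≤ (posCells ν n).card := by exact_mod_cast h1
    rw [← powSum_zero] at h2
    have h3 : (m : ℝ) ≤ A * (4 / ε) ^ c := by
      refine (h2.trans (hgrow n)).trans ?_
      rw [Real.rpow_mul zero_le_two, Real.rpow_natCast]
      gcongr
    have hm' : (0 : ℝ) < m := by exact_mod_cast hm0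
    have h4 := Real.log_le_log hm' h3
    have hlog : 0 < -Real.log ε := neg_pos.2 (Real.log_neg hε.1 hε.2)
    rw [Real.div_rpow (by norm_num) hε.1.le, ← mul_div_assoc, Real.log_div (by positivity)
      (Real.rpow_pos_of_pos hε.1 _).ne', Real.log_rpow hε.1] at h4
    rw [div_le_iff₀ hlog, add_mul, div_mul_cancel₀ _ hlog.ne']
    linarith
  · refine EReal.le_of_forall_lt_iff_le.1 fun c hc => ?_
    rw [EReal.coe_le_coe_iff]
    refine HasGrowth.lqReal_le hν hsupp le_rfl ?_
    have hev := eventually_lt_of_limsup_lt hc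
    have hlim : Tendsto (fun n : ℕ => ((2 : ℝ) ^ n)⁻¹) atTop (𝓝[>] 0) := by
      refine tendsto_nhdsWithin_iff.2 ⟨?_, Eventually.of_forall fun n => by simp⟩
      exact tendsto_inv_atTop_zero.comp (tendsto_pow_atTop_atTop_of_one_lt one_lt_two)
    obtain ⟨N, hN⟩ := eventually_atTop.1 (hlim.eventually hev)
    refine hasGrowth_of_eventually three_pos ?_
    filter_upwards [eventually_ge_atTop (max N 1)] with n hn
    obtain ⟨m, hm0, hm⟩ := hnum ((2 : ℝ) ^ n)⁻¹ (by positivity)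
    have h1 := hN n (le_of_max_le_left hn)
    have hn1 : 1 ≤ n := le_of_max_le_right hn
    rw [hm, log_toENNReal_div hm0, EReal.coe_lt_coe_iff, Real.log_inv, neg_neg, div_lt_iff₀
      (Real.log_pos (one_lt_pow₀ one_lt_two (by omega))), Real.log_pow] at h1
    have hm' : (0 : ℝ) < m := by exact_mod_cast hm0
    have h2 : (m : ℝ) ≤ (2 : ℝ) ^ ((n : ℝ) * c) := by
      rw [← Real.log_le_log_iff hm' (by positivity), Real.log_rpow two_pos]
      linarith
    have h3 : ((posCells ν n).card : ℝ) ≤ 3 * m := by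
      exact_mod_cast card_posCells_le_coveringNumber hsupp n hm
    rw [powSum_zero]
    linarith

end Covering

/-! ### Heavy cells and the number of eigenvalues. -/

open Classical in
/-- The indices of the dyadic cells of level `n` with measure at least `m`. -/
def heavyCells (ν : Measure ℝ) (n : ℕ) (m : ℝ) : Finset ℕ :=
  (Finset.range (2 ^ n)).filter fun k => m ≤ ν.real (dyadicCell n k)

theorem mem_heavyCells {ν : Measure ℝ} {n k : ℕ} {m : ℝ} :
    k ∈ heavyCells ν n m ↔ k < 2 ^ n ∧ m ≤ ν.real (dyadicCell n k) := by
  simp [heavyCells]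

/-- The eigenvalue counting function as a natural number. -/
def eigenvalueNum (ν : Measure ℝ) (x : ℝ) : ℕ := (eigenvalueCount ν x).toNat

section Bounds

variable {ν : Measure ℝ} [IsFiniteMeasure ν]

omit [IsFiniteMeasure ν] in
theorem heavyCells_subset_posCells {n : ℕ} {m : ℝ} (hm : 0 < m) :
    heavyCells ν n m ⊆ posCells ν n := by
  intro k hk
  rw [mem_heavyCells] at hk
  refine mem_posCells.2 ⟨hk.1, ?_⟩
  have := hm.trans_le hk.2
  rw [measureReal_def, ENNReal.toReal_pos_iff] at this
  exact this.1

-- Chebyshev's inequality for the `q`-th powers.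
omit [IsFiniteMeasure ν] in
theorem card_heavyCells_mul_le {n : ℕ} {m q : ℝ} (hm : 0 < m) (hq : 0 ≤ q) :
    (heavyCells ν n m).card * m ^ q ≤ powSum ν n q := by
  rw [← nsmul_eq_mul, ← Finset.sum_const]
  refine (Finset.sum_le_sum fun k hk => ?_).trans (Finset.sum_le_sum_of_subset_of_nonneg
    (heavyCells_subset_posCells hm) fun _ _ _ => Real.rpow_nonneg measureReal_nonneg _)
  exact Real.rpow_le_rpow hm.le (mem_heavyCells.1 hk).2 hq

theorem eigenvalueCount_le_sum_card (hsupp : ν (Ioo (0 : ℝ) 1)ᶜ = 0) {x t : ℝ} (ht : 0 < t)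
    (hxt : x * t < 1) :
    ∃ N : ℕ, eigenvalueCount ν x ≤
      ((∑ n ∈ Finset.range N, (heavyCells ν n (t * 2 ^ n)).card : ℕ) : ℕ∞) := by
  obtain ⟨N, hN⟩ := pow_unbounded_of_one_lt (ν.real univ / t) (one_lt_two (α := ℝ))
  rw [div_lt_iff₀ ht] at hN
  refine ⟨N, (eigenvalueCount_le_card hsupp ht hxt ((Finset.range N).biUnion fun n =>
    (heavyCells ν n (t * 2 ^ n)).image fun k => (n, k)) fun n k hk h => ?_).trans ?_⟩
  · refine Finset.mem_biUnion.2 ⟨n, Finset.mem_range.2 ?_, Finset.mem_image.2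
      ⟨k, mem_heavyCells.2 ⟨hk, h.le⟩, rfl⟩⟩
    by_contra! hNn
    have h1 : ν.real (dyadicCell n k) ≤ ν.real univ := measureReal_mono (subset_univ _)
    have h2 : (2 : ℝ) ^ N ≤ 2 ^ n := pow_le_pow_right₀ (by norm_num) hNn
    nlinarith
  · exact_mod_cast Finset.card_biUnion_le.trans
      (Finset.sum_le_sum fun n _ => Finset.card_image_le)

/-- `ENat.toNat` would turn `⊤` into 0. The count is finite, so nothing is lost. -/
theorem coe_eigenvalueNum (hsupp : ν (Ioo (0 : ℝ) 1)ᶜ = 0) (x : ℝ) :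
    (eigenvalueNum ν x : ℕ∞) = eigenvalueCount ν x := by
  refine ENat.natCast_toNat ?_
  have ht : 0 < (|x| + 1)⁻¹ := by positivity
  obtain ⟨N, hN⟩ := eigenvalueCount_le_sum_card hsupp ht (x := x) (by
    rw [← div_eq_mul_inv, div_lt_one (by positivity)]
    linarith [le_abs_self x])
  exact ne_top_of_le_ne_top (ENat.natCast_ne_top _) hN

/-- Upper bound for the number of eigenvalues in terms of the growth of the dyadic power sums. -/
theorem exists_eigenvalueNum_le (hsupp : ν (Ioo (0 : ℝ) 1)ᶜ = 0) {q c : ℝ} (hq : 0 < q)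
    (hcq : c < q) (h : HasGrowth ν q c) :
    ∃ B > 0, ∀ x > 0, (eigenvalueNum ν x : ℝ) ≤ B * x ^ q := by
  obtain ⟨A, hA, h⟩ := h
  -- Level `n` will contribute at most a constant times $x^q r^n$. The assumption `c < q` makes the
  -- series over all levels converge.
  set r : ℝ := (2 : ℝ) ^ (c - q) with hr
  have hr0 : 0 < r := by positivity
  have hr1 : r < 1 := Real.rpow_lt_one_of_one_lt_of_neg one_lt_two (by linarith)
  have hr1' : 0 < 1 - r := by linarith
  refine ⟨A * 2 ^ q * (1 - r)⁻¹, by positivity, fun x hx => ?_⟩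
  have ht : 0 < (2 * x)⁻¹ := by positivity
  obtain ⟨N, hN⟩ := eigenvalueCount_le_sum_card hsupp ht (x := x) (by
    rw [← div_eq_mul_inv, div_lt_one (by positivity)]; linarith)
  rw [← coe_eigenvalueNum hsupp] at hN
  have hN' : (eigenvalueNum ν x : ℝ) ≤
      ∑ n ∈ Finset.range N, ((heavyCells ν n ((2 * x)⁻¹ * 2 ^ n)).card : ℝ) := by
    exact_mod_cast hN
  have hterm : ∀ n : ℕ, ((heavyCells ν n ((2 * x)⁻¹ * 2 ^ n)).card : ℝ) ≤
      A * 2 ^ q * x ^ q * r ^ n := by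
    intro n
    have h1 := (card_heavyCells_mul_le (ν := ν) (n := n) (m := (2 * x)⁻¹ * 2 ^ n) (by positivity)
      hq.le).trans (h n)
    have h2 : ((2 * x)⁻¹ * (2 : ℝ) ^ n) ^ q = (2 ^ q * x ^ q)⁻¹ * (2 : ℝ) ^ ((n : ℝ) * q) := by
      rw [Real.mul_rpow (by positivity) (by positivity), Real.inv_rpow (by positivity),
        Real.mul_rpow (by positivity) hx.le, Real.rpow_mul zero_le_two, Real.rpow_natCast]
    have h3 : r ^ n = (2 : ℝ) ^ ((n : ℝ) * c) / (2 : ℝ) ^ ((n : ℝ) * q) := by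
      rw [hr, ← Real.rpow_natCast, ← Real.rpow_mul zero_le_two, ← Real.rpow_sub two_pos]
      congr 1; ring
    have hxq : 0 < x ^ q := Real.rpow_pos_of_pos hx q
    rw [h2] at h1
    rw [h3, ← mul_div_assoc, le_div_iff₀ (by positivity)]
    calc ((heavyCells ν n ((2 * x)⁻¹ * 2 ^ n)).card : ℝ) * (2 : ℝ) ^ ((n : ℝ) * q)
        = (heavyCells ν n ((2 * x)⁻¹ * 2 ^ n)).card *
            ((2 ^ q * x ^ q)⁻¹ * (2 : ℝ) ^ ((n : ℝ) * q)) * (2 ^ q * x ^ q) := by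
          field_simp
      _ ≤ A * (2 : ℝ) ^ ((n : ℝ) * c) * (2 ^ q * x ^ q) :=
          mul_le_mul_of_nonneg_right h1 (by positivity)
      _ = _ := by ring
  have hxq : 0 < x ^ q := Real.rpow_pos_of_pos hx q
  have hgeom : ∑ n ∈ Finset.range N, r ^ n ≤ (1 - r)⁻¹ := by
    rw [← tsum_geometric_of_lt_one hr0.le hr1]
    exact (summable_geometric_of_lt_one hr0.le hr1).sum_le_tsum _ fun _ _ => by positivity
  calc (eigenvalueNum ν x : ℝ) ≤ ∑ n ∈ Finset.range N, A * 2 ^ q * x ^ q * r ^ n :=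
        hN'.trans (Finset.sum_le_sum fun n _ => hterm n)
    _ = A * 2 ^ q * x ^ q * ∑ n ∈ Finset.range N, r ^ n := by rw [Finset.mul_sum]
    _ ≤ A * 2 ^ q * x ^ q * (1 - r)⁻¹ := mul_le_mul_of_nonneg_left hgeom (by positivity)
    _ = _ := by ring

/-- The trapezoid that is 1 on a cell and falls to 0 across its two neighbours has energy
$2\cdot2^n$, so its Rayleigh quotient is below `x`. Trapezoids in one residue class modulo 3 do not
overlap, whence the factor 3. The first and last cells lack a neighbour, whence the 2. -/
theorem card_heavyCells_le (hsupp : ν (Ioo (0 : ℝ) 1)ᶜ = 0) {n : ℕ} {m x : ℝ} (hx : 0 < x)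
    (h : 2 * 2 ^ n < x * m) : (heavyCells ν n m).card ≤ 3 * eigenvalueNum ν x + 2 := by
  have h2 : (0 : ℝ) < 2 ^ n := by positivity
  let F : ℕ → Finset ℕ := fun r =>
    (heavyCells ν n m).filter fun k => 1 ≤ k ∧ k + 2 ≤ 2 ^ n ∧ k % 3 = r
  have hF : ∀ r, (F r).card ≤ eigenvalueNum ν x := by
    intro r
    have hmem : ∀ i : F r, (i : ℕ) < 2 ^ n ∧ m ≤ ν.real (dyadicCell n i) ∧ 1 ≤ (i : ℕ) ∧
        (i : ℕ) + 2 ≤ 2 ^ n ∧ (i : ℕ) % 3 = r := by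
      intro i
      have := Finset.mem_filter.1 i.2
      rw [mem_heavyCells] at this
      exact ⟨this.1.1, this.1.2, this.2⟩
    have := card_le_eigenvalueCount ν (ι := F r) (x := x)
      (a := fun i => ((i : ℕ) - 1 : ℝ) / 2 ^ n) (b := fun i => ((i : ℕ) : ℝ) / 2 ^ n)
      (c := fun i => ((i : ℕ) + 1 : ℝ) / 2 ^ n) (d := fun i => ((i : ℕ) + 2 : ℝ) / 2 ^ n)
      (fun i => by
        have : (1 : ℝ) ≤ (i : ℕ) := by exact_mod_cast (hmem i).2.2.1
        exact div_nonneg (by linarith) h2.le)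
      (fun i => by gcongr; linarith) (fun i => by gcongr; linarith)
      (fun i => by gcongr; norm_num)
      (fun i => by
        rw [div_le_one h2]
        exact_mod_cast (hmem i).2.2.2.1)
      (fun i j hij => by
        have hij' : (i : ℕ) ≠ j := fun h => hij (Subtype.ext h)
        have hi := (hmem i).2.2.2.2
        have hj := (hmem j).2.2.2.2
        rcases lt_or_gt_of_ne hij' with h | h
        · left
          have : (i : ℕ) + 3 ≤ j := by omega
          have : ((i : ℕ) : ℝ) + 3 ≤ (j : ℕ) := by exact_mod_cast this
          gcongr; linarith
        · right
          have : (j : ℕ) + 3 ≤ i := by omega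
          have : ((j : ℕ) : ℝ) + 3 ≤ (i : ℕ) := by exact_mod_cast this
          gcongr; linarith)
      hx
      (fun i => by
        have e1 : (((i : ℕ) : ℝ) / 2 ^ n - ((i : ℕ) - 1 : ℝ) / 2 ^ n)⁻¹ = 2 ^ n := by
          rw [← sub_div]; simp
        have e2 : (((i : ℕ) + 2 : ℝ) / 2 ^ n - ((i : ℕ) + 1 : ℝ) / 2 ^ n)⁻¹ = 2 ^ n := by
          rw [← sub_div, show ((i : ℕ) + 2 : ℝ) - ((i : ℕ) + 1) = 1 by ring]; simp
        rw [e1, e2]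
        have e3 : m ≤ ν.real (Icc (((i : ℕ) : ℝ) / 2 ^ n) (((i : ℕ) + 1 : ℝ) / 2 ^ n)) :=
          (hmem i).2.1.trans (measureReal_mono Ioc_subset_Icc_self)
        have := mul_le_mul_of_nonneg_left e3 hx.le
        linarith)
    rw [← coe_eigenvalueNum hsupp, Fintype.card_coe] at this
    exact_mod_cast this
  have hsub : heavyCells ν n m ⊆ (F 0 ∪ F 1 ∪ F 2) ∪ {0, 2 ^ n - 1} := by
    intro k hk
    have hk1 := (mem_heavyCells.1 hk).1
    simp only [F, Finset.mem_union, Finset.mem_filter, hk, true_and, Finset.mem_insert,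
      Finset.mem_singleton]
    omega
  have := Finset.card_le_card hsub
  have h3 := Finset.card_union_le (F 0 ∪ F 1 ∪ F 2) {0, 2 ^ n - 1}
  have h4 := Finset.card_union_le (F 0 ∪ F 1) (F 2)
  have h5 := Finset.card_union_le (F 0) (F 1)
  have h6 := Finset.card_le_two (a := 0) (b := 2 ^ n - 1)
  have := hF 0
  have := hF 1
  have := hF 2
  omega

/-- Some interval `[δ, 1 - δ]` has positive mass, and a single trapezoid over it, of energy `2 *
δ⁻¹`, already yields an eigenvalue. -/
theorem exists_one_le_eigenvalueNum (hν : ν ≠ 0) (hsupp : ν (Ioo (0 : ℝ) 1)ᶜ = 0) :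
    ∃ x₀ > 0, ∀ x ≥ x₀, 1 ≤ eigenvalueNum ν x := by
  obtain ⟨n, hn⟩ : ∃ n : ℕ, 0 < ν.real (Icc (1 / ((n : ℝ) + 2)) (1 - 1 / ((n : ℝ) + 2))) := by
    by_contra! h
    have h0 : ∀ n : ℕ, ν (Icc (1 / ((n : ℝ) + 2)) (1 - 1 / ((n : ℝ) + 2))) = 0 := fun n =>
      (measureReal_eq_zero_iff).1 (le_antisymm (h n) measureReal_nonneg)
    refine hν (Measure.measure_univ_eq_zero.1 ?_)
    refine measure_mono_null (t := (Ioo (0 : ℝ) 1)ᶜ ∪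
      ⋃ n : ℕ, Icc (1 / ((n : ℝ) + 2)) (1 - 1 / ((n : ℝ) + 2))) (fun y _ => ?_)
      (measure_union_null hsupp (measure_iUnion_null h0))
    by_cases hy : y ∈ Ioo (0 : ℝ) 1
    · obtain ⟨n, hn⟩ := exists_nat_one_div_lt (lt_min hy.1 (sub_pos.2 hy.2))
      have h1 : 1 / ((n : ℝ) + 2) ≤ 1 / ((n : ℝ) + 1) := by gcongr; norm_num
      have h2 := lt_min_iff.1 hn
      exact Or.inr (mem_iUnion.2 ⟨n, by linarith, by linarith⟩)
    · exact Or.inl hy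
  set δ : ℝ := 1 / ((n : ℝ) + 2) with hδ
  have hδ0 : 0 < δ := by positivity
  have hδ1 : δ ≤ 1 - δ := by
    have : δ ≤ 1 / 2 := by rw [hδ]; gcongr; linarith [Nat.cast_nonneg (α := ℝ) n]
    linarith
  set p := ν.real (Icc δ (1 - δ))
  refine ⟨3 * δ⁻¹ / p, by positivity, fun x hx => ?_⟩
  have hx0 : 0 < x := lt_of_lt_of_le (by positivity) hx
  have := card_le_eigenvalueCount ν (ι := Unit) (x := x) (a := fun _ => 0) (b := fun _ => δ)
    (c := fun _ => 1 - δ) (d := fun _ => 1) (fun _ => le_rfl) (fun _ => hδ0) (fun _ => hδ1)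
    (fun _ => by linarith) (fun _ => le_rfl) (fun i j hij => absurd (Subsingleton.elim i j) hij)
    hx0 (fun _ => by
      rw [ge_iff_le, div_le_iff₀ hn] at hx
      rw [sub_zero, sub_sub_cancel]
      have : 0 < δ⁻¹ := by positivity
      linarith)
  rw [← coe_eigenvalueNum hsupp] at this
  simpa using this

/-- Polynomial growth of the number of eigenvalues bounds the dyadic power sums. -/
theorem hasGrowth_of_eigenvalueNum_le (hν : ν ≠ 0) (hsupp : ν (Ioo (0 : ℝ) 1)ᶜ = 0) {s q x₁ : ℝ}
    (hs : 0 ≤ s) (hsq : s < q) (h : ∀ x ≥ x₁, (eigenvalueNum ν x : ℝ) ≤ x ^ s) :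
    HasGrowth ν q s := by
  have hM := measureReal_univ_pos hν
  set M := ν.real univ
  set K : ℝ := max x₁ (max 1 (4 / M)) with hK
  have hK1 : 1 ≤ K := (le_max_left _ _).trans (le_max_right _ _)
  have hKM : 4 ≤ K * M := by
    rw [← div_le_iff₀ hM]; exact (le_max_right _ _).trans (le_max_right _ _)
  -- The hypothesis is used at $x=K2^{n+j+1}$, chosen so that $x\cdot M/2^{j+1}=KM2^n\ge4\cdot2^n$,
  -- as `card_heavyCells_le` requires.
  have hcount : ∀ n j : ℕ, ((heavyCells ν n (M / 2 ^ (j + 1))).card : ℝ) ≤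
      (3 * (2 * K) ^ s + 2) * (2 : ℝ) ^ ((n : ℝ) * s) * ((2 : ℝ) ^ s) ^ j := by
    intro n j
    have hp : (1 : ℝ) ≤ 2 ^ (n + j + 1) := one_le_pow₀ one_le_two
    have hx1 : x₁ ≤ K * 2 ^ (n + j + 1) :=
      (le_max_left _ _).trans (le_mul_of_one_le_right (by linarith) hp)
    have hxp : 0 < K * 2 ^ (n + j + 1) := by positivity
    have h1 := card_heavyCells_le hsupp (n := n) (m := M / 2 ^ (j + 1)) hxp (by
      have e : K * 2 ^ (n + j + 1) * (M / 2 ^ (j + 1)) = K * M * 2 ^ n := by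
        rw [add_assoc, pow_add]; field_simp
      rw [e]
      have : (0 : ℝ) < 2 ^ n := by positivity
      nlinarith)
    have h1' : ((heavyCells ν n (M / 2 ^ (j + 1))).card : ℝ) ≤
        3 * eigenvalueNum ν (K * 2 ^ (n + j + 1)) + 2 := by exact_mod_cast h1
    have h2 := h _ hx1
    have e : (K * 2 ^ (n + j + 1)) ^ s = (2 * K) ^ s * ((2 : ℝ) ^ ((n : ℝ) * s) * (2 ^ s) ^ j) := by
      rw [show K * (2 : ℝ) ^ (n + j + 1) = (2 * K) * (2 ^ n * 2 ^ j) by ring,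
        Real.mul_rpow (x := 2 * K) (by positivity) (by positivity),
        Real.mul_rpow (x := 2 ^ n) (by positivity) (by positivity), Real.rpow_mul zero_le_two,
        Real.rpow_natCast, Real.rpow_pow_comm zero_le_two]
    have e2 : (1 : ℝ) ≤ (2 : ℝ) ^ ((n : ℝ) * s) * (2 ^ s) ^ j :=
      one_le_mul_of_one_le_of_one_le (Real.one_le_rpow one_le_two (by positivity))
        (one_le_pow₀ (Real.one_le_rpow one_le_two hs))
    rw [e] at h2
    nlinarith
  set r : ℝ := (2 : ℝ) ^ (s - q) with hr
  have hr0 : 0 < r := by positivity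
  have hr1 : r < 1 := Real.rpow_lt_one_of_one_lt_of_neg one_lt_two (by linarith)
  have hr1' : 0 < 1 - r := by linarith
  refine ⟨(3 * (2 * K) ^ s + 2) * M ^ q * (1 - r)⁻¹, by positivity, fun n => ?_⟩
  -- Cells are sorted by the dyadic size of their mass relative to `M`. Class `j` contributes a
  -- multiple of $2^{ns}r^j$, which is summable because `s < q`.
  have hlevel : ∀ k ∈ posCells ν n, ∃ j : ℕ, M / 2 ^ (j + 1) ≤ ν.real (dyadicCell n k) ∧
      ν.real (dyadicCell n k) ≤ M / 2 ^ j := by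
    intro k hk
    have hpos := pos_of_mem_posCells hk
    obtain ⟨j, h1, h2⟩ := exists_nat_pow_near (x := M / ν.real (dyadicCell n k)) (y := (2 : ℝ))
      (by rw [one_le_div hpos]; exact measureReal_mono (subset_univ _)) one_lt_two
    refine ⟨j, ?_, ?_⟩
    · rw [div_le_iff₀ (by positivity)]
      rw [div_lt_iff₀ hpos] at h2
      linarith
    · rw [le_div_iff₀ (by positivity)]
      rw [le_div_iff₀ hpos] at h1
      linarith
  choose! lev hlev using hlevel
  set J := (posCells ν n).sup lev + 1 with hJ
  have hbound : powSum ν n q ≤ ∑ j ∈ Finset.range J,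
      ((heavyCells ν n (M / 2 ^ (j + 1))).card : ℝ) * (M / 2 ^ j) ^ q := by
    have hmaps : ∀ k ∈ posCells ν n, lev k ∈ Finset.range J := fun k hk =>
      Finset.mem_range.2 (Nat.lt_succ_of_le (Finset.le_sup hk))
    rw [powSum, ← Finset.sum_fiberwise_of_maps_to hmaps]
    refine Finset.sum_le_sum fun j _ => ?_
    rw [← nsmul_eq_mul]
    refine (Finset.sum_le_card_nsmul _ _ ((M / 2 ^ j) ^ q) fun k hk => ?_).trans ?_
    · obtain ⟨hk', rfl⟩ := Finset.mem_filter.1 hk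
      exact Real.rpow_le_rpow measureReal_nonneg (hlev k hk').2 (by linarith)
    · have hsub : (posCells ν n).filter (fun k => lev k = j) ⊆
          heavyCells ν n (M / 2 ^ (j + 1)) := by
        intro k hk
        obtain ⟨hk', rfl⟩ := Finset.mem_filter.1 hk
        exact mem_heavyCells.2 ⟨(mem_posCells.1 hk').1, (hlev k hk').1⟩
      exact nsmul_le_nsmul_left (by positivity) (Finset.card_le_card hsub)
  have hgeom : ∑ n ∈ Finset.range J, r ^ n ≤ (1 - r)⁻¹ := by
    rw [← tsum_geometric_of_lt_one hr0.le hr1]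
    exact (summable_geometric_of_lt_one hr0.le hr1).sum_le_tsum _ fun _ _ => by positivity
  refine hbound.trans ?_
  calc ∑ j ∈ Finset.range J, ((heavyCells ν n (M / 2 ^ (j + 1))).card : ℝ) * (M / 2 ^ j) ^ q
      ≤ ∑ j ∈ Finset.range J,
          (3 * (2 * K) ^ s + 2) * (2 : ℝ) ^ ((n : ℝ) * s) * M ^ q * r ^ j := by
        refine Finset.sum_le_sum fun j _ => ?_
        have e : (M / 2 ^ j) ^ q * ((2 : ℝ) ^ s) ^ j = M ^ q * r ^ j := by
          rw [Real.div_rpow hM.le (by positivity), hr, Real.rpow_sub two_pos, div_pow,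
            Real.rpow_pow_comm zero_le_two q]
          ring
        calc ((heavyCells ν n (M / 2 ^ (j + 1))).card : ℝ) * (M / 2 ^ j) ^ q
            ≤ (3 * (2 * K) ^ s + 2) * (2 : ℝ) ^ ((n : ℝ) * s) * ((2 : ℝ) ^ s) ^ j *
                (M / 2 ^ j) ^ q := mul_le_mul_of_nonneg_right (hcount n j) (by positivity)
          _ = _ := by linear_combination ((3 * (2 * K) ^ s + 2) * (2 : ℝ) ^ ((n : ℝ) * s)) * e
    _ = (3 * (2 * K) ^ s + 2) * (2 : ℝ) ^ ((n : ℝ) * s) * M ^ q * ∑ j ∈ Finset.range J, r ^ j := by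
        rw [Finset.mul_sum]
    _ ≤ (3 * (2 * K) ^ s + 2) * (2 : ℝ) ^ ((n : ℝ) * s) * M ^ q * (1 - r)⁻¹ :=
        mul_le_mul_of_nonneg_left hgeom (by positivity)
    _ = _ := by ring

end Bounds

/-! ### Bounds for the spectral dimensions. -/

section SpectralDim

variable {ν : Measure ℝ} [IsFiniteMeasure ν]

theorem eventually_spectralQuotient_eq (hν : ν ≠ 0) (hsupp : ν (Ioo (0 : ℝ) 1)ᶜ = 0) :
    ∀ᶠ x in atTop, 1 ≤ eigenvalueNum ν x ∧ 1 < x ∧ spectralQuotient ν x =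
      ((Real.log (eigenvalueNum ν x) / Real.log x : ℝ) : EReal) := by
  obtain ⟨x₀, -, h⟩ := exists_one_le_eigenvalueNum hν hsupp
  filter_upwards [eventually_ge_atTop x₀, eventually_gt_atTop 1] with x hx hx1
  refine ⟨h x hx, hx1, ?_⟩
  rw [spectralQuotient, ← coe_eigenvalueNum hsupp, log_toENNReal_div (h x hx)]

theorem HasGrowth.upperSpectralDim_le (hν : ν ≠ 0) (hsupp : ν (Ioo (0 : ℝ) 1)ᶜ = 0) {q c : ℝ}
    (hq : 0 < q) (hcq : c < q) (h : HasGrowth ν q c) : upperSpectralDim ν ≤ (q : EReal) := by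
  obtain ⟨B, hB, h⟩ := exists_eigenvalueNum_le hsupp hq hcq h
  have hlim : Tendsto (fun x : ℝ => ((q + Real.log B / Real.log x : ℝ) : EReal)) atTop
      (𝓝 (q : EReal)) := by
    refine continuous_coe_real_ereal.continuousAt.tendsto.comp ?_
    simpa using (tendsto_const_nhds (x := q)).add
      (Real.tendsto_log_atTop.const_div_atTop (Real.log B))
  rw [← hlim.limsup_eq, upperSpectralDim]
  refine limsup_le_limsup ?_
  filter_upwards [eventually_spectralQuotient_eq hν hsupp] with x ⟨hx1, hx2, hx3⟩
  have hx0 : 0 < x := by linarith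
  have hn : (0 : ℝ) < eigenvalueNum ν x := by exact_mod_cast hx1
  have hlog := Real.log_pos hx2
  have h1 := Real.log_le_log hn (h x hx0)
  rw [Real.log_mul hB.ne' (Real.rpow_pos_of_pos hx0 _).ne', Real.log_rpow hx0] at h1
  rw [hx3, EReal.coe_le_coe_iff, div_le_iff₀ hlog, add_mul, div_mul_cancel₀ _ hlog.ne']
  linarith

theorem exists_eigenvalueNum_le_rpow (hν : ν ≠ 0) (hsupp : ν (Ioo (0 : ℝ) 1)ᶜ = 0) {s : ℝ}
    (h : upperSpectralDim ν < (s : EReal)) :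
    ∃ x₁, ∀ x ≥ x₁, (eigenvalueNum ν x : ℝ) ≤ x ^ s := by
  refine eventually_atTop.1 ?_
  filter_upwards [eventually_lt_of_limsup_lt h, eventually_spectralQuotient_eq hν hsupp]
    with x hx ⟨hx1, hx2, hx3⟩
  have hx0 : 0 < x := by linarith
  have hn : (0 : ℝ) < eigenvalueNum ν x := by exact_mod_cast hx1
  rw [hx3, EReal.coe_lt_coe_iff, div_lt_iff₀ (Real.log_pos hx2)] at hx
  rw [← Real.log_le_log_iff hn (Real.rpow_pos_of_pos hx0 _), Real.log_rpow hx0]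
  exact hx.le

theorem le_lowerSpectralDim (hν : ν ≠ 0) (hsupp : ν (Ioo (0 : ℝ) 1)ᶜ = 0) {s K : ℝ} (hK : 0 < K)
    (h : ∀ᶠ x in atTop, K * x ^ s ≤ (eigenvalueNum ν x : ℝ)) :
    (s : EReal) ≤ lowerSpectralDim ν := by
  have hlim : Tendsto (fun x : ℝ => ((s + Real.log K / Real.log x : ℝ) : EReal)) atTop
      (𝓝 (s : EReal)) := by
    refine continuous_coe_real_ereal.continuousAt.tendsto.comp ?_
    simpa using (tendsto_const_nhds (x := s)).add
      (Real.tendsto_log_atTop.const_div_atTop (Real.log K))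
  rw [← hlim.liminf_eq, lowerSpectralDim]
  refine liminf_le_liminf ?_
  filter_upwards [h, eventually_spectralQuotient_eq hν hsupp] with x hx ⟨hx1, hx2, hx3⟩
  have hx0 : 0 < x := by linarith
  have hxs : 0 < x ^ s := Real.rpow_pos_of_pos hx0 _
  have hlog := Real.log_pos hx2
  have h1 := Real.log_le_log (by positivity) hx
  rw [Real.log_mul hK.ne' hxs.ne', Real.log_rpow hx0] at h1
  rw [hx3, EReal.coe_le_coe_iff, le_div_iff₀ hlog, add_mul, div_mul_cancel₀ _ hlog.ne']
  linarith

theorem lowerSpectralDim_nonneg (hν : ν ≠ 0) (hsupp : ν (Ioo (0 : ℝ) 1)ᶜ = 0) :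
    0 ≤ lowerSpectralDim ν := by
  refine le_lowerSpectralDim hν hsupp (s := 0) one_pos ?_
  filter_upwards [eventually_spectralQuotient_eq hν hsupp] with x hx
  rw [Real.rpow_zero, one_mul]
  exact_mod_cast hx.1

/-- Most of the mass sits in dyadic cells of measure between `2^(-n a)` and `2^(-n b)`. -/
theorem eventually_le_card_heavyCells (hν : ν ≠ 0) (hsupp : ν (Ioo (0 : ℝ) 1)ᶜ = 0)
    {a b t c t' c' : ℝ} (ht : t < 1) (hc : c < a * (1 - t)) (h : HasGrowth ν t c)
    (ht' : 1 < t') (hc' : c' < b * (1 - t')) (h' : HasGrowth ν t' c') :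
    ∀ᶠ n : ℕ in atTop, ν.real univ / 2 * (2 : ℝ) ^ ((n : ℝ) * b) ≤
      (heavyCells ν n ((2 : ℝ) ^ (-((n : ℝ) * a)))).card := by
  obtain ⟨A, hA, h⟩ := h
  obtain ⟨A', hA', h'⟩ := h'
  have hM := measureReal_univ_pos hν
  have htend : ∀ (C e : ℝ), e < 0 →
      Tendsto (fun n : ℕ => C * (2 : ℝ) ^ ((n : ℝ) * e)) atTop (𝓝 0) := by
    intro C e he
    have := (tendsto_pow_atTop_nhds_zero_of_lt_one (r := (2 : ℝ) ^ e) (by positivity)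
      (Real.rpow_lt_one_of_one_lt_of_neg one_lt_two he)).const_mul C
    rw [mul_zero] at this
    refine this.congr fun n => ?_
    rw [← Real.rpow_natCast, ← Real.rpow_mul zero_le_two, mul_comm e]
  -- The mass of the too light cells and of the too heavy cells decays exponentially, so together
  -- they eventually carry less than half of the total.
  have h0 := (htend A (c - a * (1 - t)) (by linarith)).add
    (htend A' (c' - b * (1 - t')) (by linarith))
  rw [add_zero] at h0
  filter_upwards [h0.eventually (gt_mem_nhds (half_pos hM))] with n hn
  -- Masses below $2^{-na}$ are absorbed by the `t`-th power, masses above $2^{-nb}$ by the `t'`-th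
  -- power. Each remaining cell has mass at most $2^{-nb}$.
  have hpt : ∀ k ∈ posCells ν n, ν.real (dyadicCell n k) ^ (1 : ℝ) ≤
      (if (2 : ℝ) ^ (-((n : ℝ) * a)) ≤ ν.real (dyadicCell n k) then
        (2 : ℝ) ^ (-((n : ℝ) * b)) else 0) +
      ν.real (dyadicCell n k) ^ t * (2 : ℝ) ^ (-((n : ℝ) * a) * (1 - t)) +
      ν.real (dyadicCell n k) ^ t' * (2 : ℝ) ^ (-((n : ℝ) * b) * (1 - t')) := by
    intro k hk
    have hpos := pos_of_mem_posCells hk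
    set m := ν.real (dyadicCell n k)
    have e1 : (0 : ℝ) < m ^ t * (2 : ℝ) ^ (-((n : ℝ) * a) * (1 - t)) := by positivity
    have e2 : (0 : ℝ) < m ^ t' * (2 : ℝ) ^ (-((n : ℝ) * b) * (1 - t')) := by positivity
    split_ifs with hcase
    · rcases le_or_gt m ((2 : ℝ) ^ (-((n : ℝ) * b))) with hb | hb
      · rw [Real.rpow_one]; linarith
      · have e3 : m ^ (1 : ℝ) = m ^ t' * m ^ (1 - t') := by
          rw [← Real.rpow_add hpos]; congr 1; ring
        have e4 : m ^ (1 - t') ≤ (2 : ℝ) ^ (-((n : ℝ) * b) * (1 - t')) := by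
          rw [Real.rpow_mul zero_le_two]
          exact Real.rpow_le_rpow_of_nonpos (by positivity) hb.le (by linarith)
        have e5 := mul_le_mul_of_nonneg_left e4 (Real.rpow_nonneg hpos.le t')
        have e6 : (0 : ℝ) < (2 : ℝ) ^ (-((n : ℝ) * b)) := by positivity
        rw [e3]; linarith
    · have e3 : m ^ (1 : ℝ) = m ^ t * m ^ (1 - t) := by
        rw [← Real.rpow_add hpos]; congr 1; ring
      have e4 : m ^ (1 - t) ≤ (2 : ℝ) ^ (-((n : ℝ) * a) * (1 - t)) := by
        rw [Real.rpow_mul zero_le_two]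
        exact Real.rpow_le_rpow hpos.le (not_le.1 hcase).le (by linarith)
      have e5 := mul_le_mul_of_nonneg_left e4 (Real.rpow_nonneg hpos.le t)
      rw [e3]; linarith
  have hsum := Finset.sum_le_sum hpt
  rw [Finset.sum_add_distrib, Finset.sum_add_distrib, ← Finset.sum_mul, ← Finset.sum_mul,
    ← Finset.sum_filter, Finset.sum_const, nsmul_eq_mul] at hsum
  change powSum ν n 1 ≤ _ + powSum ν n t * _ + powSum ν n t' * _ at hsum
  rw [powSum_one hsupp] at hsum
  have e1 : powSum ν n t * (2 : ℝ) ^ (-((n : ℝ) * a) * (1 - t)) ≤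
      A * (2 : ℝ) ^ ((n : ℝ) * (c - a * (1 - t))) := by
    refine (mul_le_mul_of_nonneg_right (h n) (by positivity)).trans (le_of_eq ?_)
    rw [mul_assoc, ← Real.rpow_add two_pos]; congr 2; ring
  have e2 : powSum ν n t' * (2 : ℝ) ^ (-((n : ℝ) * b) * (1 - t')) ≤
      A' * (2 : ℝ) ^ ((n : ℝ) * (c' - b * (1 - t'))) := by
    refine (mul_le_mul_of_nonneg_right (h' n) (by positivity)).trans (le_of_eq ?_)
    rw [mul_assoc, ← Real.rpow_add two_pos]; congr 2; ring
  have hcard : (((posCells ν n).filter fun k => (2 : ℝ) ^ (-((n : ℝ) * a)) ≤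
      ν.real (dyadicCell n k)).card : ℝ) ≤ (heavyCells ν n ((2 : ℝ) ^ (-((n : ℝ) * a)))).card := by
    refine Nat.cast_le.2 (Finset.card_le_card fun k hk => ?_)
    rw [Finset.mem_filter] at hk
    exact mem_heavyCells.2 ⟨(mem_posCells.1 hk.1).1, hk.2⟩
  have hp : (0 : ℝ) < (2 : ℝ) ^ ((n : ℝ) * b) := by positivity
  have hinv : (2 : ℝ) ^ (-((n : ℝ) * b)) * (2 : ℝ) ^ ((n : ℝ) * b) = 1 := by
    rw [← Real.rpow_add two_pos]; simp
  refine le_trans ?_ hcard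
  set k := (((posCells ν n).filter fun k => (2 : ℝ) ^ (-((n : ℝ) * a)) ≤
      ν.real (dyadicCell n k)).card : ℝ)
  have e3 : ν.real univ / 2 ≤ k * (2 : ℝ) ^ (-((n : ℝ) * b)) := by linarith
  calc ν.real univ / 2 * (2 : ℝ) ^ ((n : ℝ) * b)
      ≤ k * (2 : ℝ) ^ (-((n : ℝ) * b)) * (2 : ℝ) ^ ((n : ℝ) * b) :=
        mul_le_mul_of_nonneg_right e3 hp.le
    _ = k := by rw [mul_assoc, hinv, mul_one]

/-- At level `n` there are at least about $2^{nb}$ cells of mass at least $2^{-na}$, and their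
trapezoids have Rayleigh quotients of order at most $2^{n(1+a)}$. Matching this with `x` gives the
exponent. -/
theorem div_le_lowerSpectralDim (hν : ν ≠ 0) (hsupp : ν (Ioo (0 : ℝ) 1)ᶜ = 0)
    {a b t c t' c' : ℝ} (ha : 0 ≤ a) (hb : 0 ≤ b) (ht : t < 1) (hc : c < a * (1 - t))
    (h : HasGrowth ν t c) (ht' : 1 < t') (hc' : c' < b * (1 - t')) (h' : HasGrowth ν t' c') :
    ((b / (1 + a) : ℝ) : EReal) ≤ lowerSpectralDim ν := by
  have hM := measureReal_univ_pos hν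
  obtain ⟨N, hN⟩ := eventually_atTop.1
    (eventually_le_card_heavyCells hν hsupp ht hc h ht' hc' h')
  set g : ℝ := (2 : ℝ) ^ (1 + a) with hg
  have hg1 : 1 < g := Real.one_lt_rpow one_lt_two (by linarith)
  have hg0 : 0 < g := by linarith
  -- The 10 is 2 times 5: half of the mass is used, and $3N+2\le5N$ as soon as $N\ge1$. The factor
  -- `4 * g` is the loss in rounding `x` to a power of `g`.
  refine le_lowerSpectralDim hν hsupp (K := ν.real univ / 10 * (4 * g)⁻¹ ^ (b / (1 + a)))
    (by positivity) ?_
  filter_upwards [eventually_spectralQuotient_eq hν hsupp, eventually_ge_atTop (4 * g ^ N),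
    eventually_ge_atTop 4] with x ⟨hx1, _, _⟩ hx2 hx4
  have hx0 : 0 < x := by linarith
  obtain ⟨n, hn1, hn2⟩ := exists_nat_pow_near (x := x / 4) (y := g) (by linarith) hg1
  have hnN : N ≤ n := by
    by_contra! hlt
    have : g ^ (n + 1) ≤ g ^ N := pow_le_pow_right₀ hg1.le hlt
    linarith
  have hgn : ∀ n : ℕ, g ^ n = 2 ^ n * (2 : ℝ) ^ ((n : ℝ) * a) := by
    intro n
    rw [hg, ← Real.rpow_natCast, ← Real.rpow_mul zero_le_two, ← Real.rpow_natCast 2 n,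
      ← Real.rpow_add two_pos]
    congr 1; ring
  have hcard := card_heavyCells_le hsupp (n := n) (m := (2 : ℝ) ^ (-((n : ℝ) * a))) hx0 (by
    rw [Real.rpow_neg zero_le_two, ← div_eq_mul_inv, lt_div_iff₀ (by positivity)]
    rw [hgn] at hn1
    linarith)
  have hcard' : ((heavyCells ν n ((2 : ℝ) ^ (-((n : ℝ) * a)))).card : ℝ) ≤
      3 * eigenvalueNum ν x + 2 := by exact_mod_cast hcard
  have hnum : (1 : ℝ) ≤ eigenvalueNum ν x := by exact_mod_cast hx1
  have h1 := hN n hnN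
  have h2 : ((4 * g)⁻¹ * x) ^ (b / (1 + a)) ≤ (2 : ℝ) ^ ((n : ℝ) * b) := by
    have e1 : (4 * g)⁻¹ * x ≤ g ^ n := by
      rw [inv_mul_le_iff₀ (by positivity)]
      rw [pow_succ] at hn2
      linarith
    have e2 : (2 : ℝ) ^ ((n : ℝ) * b) = (g ^ n) ^ (b / (1 + a)) := by
      rw [hg, ← Real.rpow_natCast ((2 : ℝ) ^ (1 + a)), ← Real.rpow_mul zero_le_two,
        ← Real.rpow_mul zero_le_two]
      congr 1; field_simp
    rw [e2]
    exact Real.rpow_le_rpow (by positivity) e1 (by positivity)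
  rw [Real.mul_rpow (by positivity) hx0.le] at h2
  have h3 := mul_le_mul_of_nonneg_left h2 (half_pos hM).le
  have h4 : ν.real univ / 10 * (4 * g)⁻¹ ^ (b / (1 + a)) * x ^ (b / (1 + a)) =
      (ν.real univ / 2 * ((4 * g)⁻¹ ^ (b / (1 + a)) * x ^ (b / (1 + a)))) / 5 := by ring
  rw [h4]
  linarith

end SpectralDim

/-! ### Convexity and one-sided derivatives at 1. -/

section Derivatives

variable {ν : Measure ℝ} [IsFiniteMeasure ν]

/-- The quotient is the negated slope of the secant to the point $(1,0)$ of a convex graph. -/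
theorem lqReal_div_antitone (hν : ν ≠ 0) (hsupp : ν (Ioo (0 : ℝ) 1)ᶜ = 0) {u v : ℝ} (hu : 0 ≤ u)
    (hu1 : u ≠ 1) (hv1 : v ≠ 1) (huv : u ≤ v) :
    lqReal ν v / (1 - v) ≤ lqReal ν u / (1 - u) := by
  have h := (convexOn_lqReal hν hsupp).secant_mono (a := 1)
    (mem_Ici.2 zero_le_one) (mem_Ici.2 hu) (mem_Ici.2 (hu.trans huv)) hu1 hv1 huv
  rw [lqReal_one hν hsupp, sub_zero, sub_zero] at h
  have e : ∀ w : ℝ, lqReal ν w / (1 - w) = -(lqReal ν w / (w - 1)) := fun w => by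
    rw [← neg_sub w 1, div_neg]
  rw [e, e]
  linarith

theorem lqReal_nonneg (hν : ν ≠ 0) (hsupp : ν (Ioo (0 : ℝ) 1)ᶜ = 0) {q : ℝ} (h0 : 0 ≤ q)
    (h1 : q ≤ 1) : 0 ≤ lqReal ν q :=
  le_lqReal hν hsupp h0 fun _ hc => hc.nonneg_of_le_one hν hsupp h1

theorem tendsto_lqSpectrum_div (hν : ν ≠ 0) (hsupp : ν (Ioo (0 : ℝ) 1)ᶜ = 0) {s : Set ℝ} {d : ℝ}
    (h : Tendsto (fun t => lqReal ν t / (1 - t)) (𝓝[s] 1) (𝓝 d)) :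
    Tendsto (fun t : ℝ => lqSpectrum ν t / ((1 - t : ℝ) : EReal)) (𝓝[s] 1) (𝓝 (d : EReal)) := by
  refine (continuous_coe_real_ereal.continuousAt.tendsto.comp h).congr' ?_
  filter_upwards [mem_nhdsWithin_of_mem_nhds (Ioi_mem_nhds (zero_lt_one' ℝ))] with t ht
  rw [Function.comp_apply, EReal.coe_div, coe_lqReal hν hsupp (le_of_lt ht)]

/-- By monotonicity the limit is the infimum of the quotients. The last two clauses record that the
tangent at 1 supports the graph and that every steeper line lies above it somewhere. -/
theorem exists_left_derivative (hν : ν ≠ 0) (hsupp : ν (Ioo (0 : ℝ) 1)ᶜ = 0) :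
    ∃ d : ℝ, Tendsto (fun t => lqReal ν t / (1 - t)) (𝓝[<] 1) (𝓝 d) ∧ 0 ≤ d ∧
      (∀ t, 0 ≤ t → t < 1 → d * (1 - t) ≤ lqReal ν t) ∧
      ∀ a, d < a → ∃ t, 0 < t ∧ t < 1 ∧ lqReal ν t < a * (1 - t) := by
  set φ : ℝ → ℝ := fun t => lqReal ν t / (1 - t) with hφ
  have hnn : ∀ t ∈ Ioo (0 : ℝ) 1, 0 ≤ φ t := fun t ht =>
    div_nonneg (lqReal_nonneg hν hsupp ht.1.le ht.2.le) (by linarith [ht.2])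
  have hbdd : BddBelow (φ '' Ioo 0 1) := ⟨0, by rintro _ ⟨t, ht, rfl⟩; exact hnn t ht⟩
  have hanti : AntitoneOn φ (Ioo 0 1) := fun u hu v hv huv =>
    lqReal_div_antitone hν hsupp hu.1.le hu.2.ne hv.2.ne huv
  have hne : (Ioo (0 : ℝ) 1).Nonempty := nonempty_Ioo.2 one_pos
  refine ⟨sInf (φ '' Ioo 0 1), hanti.tendsto_nhdsWithin_Ioo_left hne hbdd,
    le_csInf (hne.image φ) (by rintro _ ⟨t, ht, rfl⟩; exact hnn t ht), fun t ht0 ht1 => ?_,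
    fun a ha => ?_⟩
  · rw [← le_div_iff₀ (by linarith)]
    -- The infimum runs over the open interval, which misses `t = 0`; a point to the right of `t`
    -- serves for all cases.
    have hm : (t + 1) / 2 ∈ Ioo (0 : ℝ) 1 := ⟨by linarith, by linarith⟩
    exact (csInf_le hbdd ⟨_, hm, rfl⟩).trans
      (lqReal_div_antitone hν hsupp ht0 ht1.ne hm.2.ne (by linarith))
  · obtain ⟨_, ⟨t, ht, rfl⟩, hta⟩ := exists_lt_of_csInf_lt (hne.image φ) ha
    exact ⟨t, ht.1, ht.2, (div_lt_iff₀ (by linarith [ht.2])).1 hta⟩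

theorem exists_right_derivative (hν : ν ≠ 0) (hsupp : ν (Ioo (0 : ℝ) 1)ᶜ = 0) :
    ∃ d : ℝ, Tendsto (fun t => lqReal ν t / (1 - t)) (𝓝[>] 1) (𝓝 d) ∧
      ∀ b, b < d → ∃ t, 1 < t ∧ lqReal ν t < b * (1 - t) := by
  set φ : ℝ → ℝ := fun t => lqReal ν t / (1 - t) with hφ
  have hbdd : BddAbove (φ '' Ioo 1 2) := by
    refine ⟨φ 0, ?_⟩
    rintro _ ⟨t, ht, rfl⟩
    exact lqReal_div_antitone hν hsupp le_rfl zero_ne_one ht.1.ne' (by linarith [ht.1])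
  have hanti : AntitoneOn φ (Ioo 1 2) := fun u hu v hv huv =>
    lqReal_div_antitone hν hsupp (by linarith [hu.1]) hu.1.ne' hv.1.ne' huv
  have hne : (Ioo (1 : ℝ) 2).Nonempty := nonempty_Ioo.2 one_lt_two
  refine ⟨sSup (φ '' Ioo 1 2), hanti.tendsto_nhdsWithin_Ioo_right hne hbdd, fun b hb => ?_⟩
  obtain ⟨_, ⟨t, ht, rfl⟩, htb⟩ := exists_lt_of_lt_csSup (hne.image φ) hb
  refine ⟨t, ht.1, ?_⟩
  have h1 : t - 1 > 0 := by linarith [ht.1]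
  have e : φ t = -lqReal ν t / (t - 1) := by
    change lqReal ν t / (1 - t) = _
    rw [← neg_sub t 1, div_neg, neg_div]
  rw [e, lt_div_iff₀ h1] at htb
  linarith

theorem upperSpectralDim_le_of_lqReal_lt (hν : ν ≠ 0) (hsupp : ν (Ioo (0 : ℝ) 1)ᶜ = 0) {q : ℝ}
    (hq : 0 < q) (h : lqReal ν q < q) : upperSpectralDim ν ≤ (q : EReal) := by
  obtain ⟨c, h1, h2⟩ := exists_between h
  exact (hasGrowth_of_lqReal_lt hν hsupp hq.le h1).upperSpectralDim_le hν hsupp hq h2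

theorem lqReal_le_chord (hν : ν ≠ 0) (hsupp : ν (Ioo (0 : ℝ) 1)ᶜ = 0) {q : ℝ} (h0 : 0 ≤ q)
    (h1 : q ≤ 1) : lqReal ν q ≤ lqReal ν 0 * (1 - q) := by
  have := (convexOn_lqReal hν hsupp).2 (x := 0) (y := 1) (mem_Ici.2 le_rfl)
    (mem_Ici.2 zero_le_one) (sub_nonneg.2 h1) h0 (by ring)
  simp only [smul_eq_mul, mul_zero, mul_one, zero_add, lqReal_one hν hsupp, add_zero] at this
  linarith

/-- If the `L^q`-spectrum lies strictly below its chord somewhere, then the upper spectral dimension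
is strictly smaller than the value determined by the Minkowski dimension. -/
theorem upperSpectralDim_lt_of_lt_chord (hν : ν ≠ 0) (hsupp : ν (Ioo (0 : ℝ) 1)ᶜ = 0) {t : ℝ}
    (ht0 : 0 < t) (ht1 : t < 1) (ht : lqReal ν t < lqReal ν 0 * (1 - t)) :
    upperSpectralDim ν < ((lqReal ν 0 / (1 + lqReal ν 0) : ℝ) : EReal) := by
  have hconv := convexOn_lqReal hν hsupp
  set D := lqReal ν 0
  have hD : 0 < D := by
    have := lqReal_nonneg hν hsupp ht0.le ht1.le
    by_contra! hD
    nlinarith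
  -- The point where the chord `D * (1 - q)` meets the diagonal. Strictness at `t` propagates to `p`
  -- by monotone secants if `t ≤ p`, and by convexity on `[0, t]` otherwise.
  set p := D / (1 + D) with hp
  have hp0 : 0 < p := by positivity
  have hp1 : p < 1 := by rw [hp, div_lt_one (by linarith)]; linarith
  have hpD : D * (1 - p) = p := by rw [hp]; field_simp; ring
  have hlt : lqReal ν p < p := by
    rcases le_total t p with h | h
    · have h1 := lqReal_div_antitone hν hsupp ht0.le ht1.ne hp1.ne h
      have h2 : lqReal ν t / (1 - t) < D := by rwa [div_lt_iff₀ (by linarith)]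
      have h3 := h1.trans_lt h2
      rw [div_lt_iff₀ (by linarith), hpD] at h3
      exact h3
    · have h1 := hconv.2 (x := 0) (y := t) (mem_Ici.2 le_rfl)
        (mem_Ici.2 ht0.le) (sub_nonneg.2 ((div_le_one ht0).2 h)) (div_nonneg hp0.le ht0.le) (by ring)
      simp only [smul_eq_mul, mul_zero, zero_add] at h1
      rw [div_mul_cancel₀ _ ht0.ne'] at h1
      have h2 : p / t * lqReal ν t < p / t * (D * (1 - t)) :=
        mul_lt_mul_of_pos_left ht (by positivity)
      have h3 : (1 - p / t) * D + p / t * (D * (1 - t)) = D * (1 - p) := by field_simp; ring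
      change lqReal ν p ≤ (1 - p / t) * D + _ at h1
      linarith
  have hcont : ContinuousAt (lqReal ν) p :=
    (hconv.subset Ioi_subset_Ici_self (convex_Ioi 0)).continuousOn isOpen_Ioi
      |>.continuousAt (Ioi_mem_nhds hp0)
  -- By continuity the strict inequality persists slightly to the left of `p`, and any such point
  -- bounds the upper spectral dimension.
  have hev : ∀ᶠ y in 𝓝[<] p, lqReal ν y < y ∧ 0 < y :=
    mem_nhdsWithin_of_mem_nhds ((hcont.tendsto.eventually_lt tendsto_id hlt).and
      (lt_mem_nhds hp0))
  obtain ⟨y, ⟨hy1, hy2⟩, hy3⟩ := (hev.and self_mem_nhdsWithin).exists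
  exact (upperSpectralDim_le_of_lqReal_lt hν hsupp hy2 hy1).trans_lt (EReal.coe_lt_coe_iff.2 hy3)

end Derivatives

end

end KreinFeller

/-! ### Conclusion. -/

theorem corollary1p6 (ν : MeasureTheory.Measure ℝ) [MeasureTheory.IsFiniteMeasure ν]
    (hν : ν ≠ 0) (hsupp : ν (Set.Ioo (0 : ℝ) 1)ᶜ = 0) :
    ∃ dLow dUp dStar sLow sUp : ℝ,
      Tendsto (fun t : ℝ => KreinFeller.lqSpectrum ν t / ((1 - t : ℝ) : EReal))
        (𝓝[>] (1 : ℝ)) (𝓝 (dLow : EReal)) ∧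
      Tendsto (fun t : ℝ => KreinFeller.lqSpectrum ν t / ((1 - t : ℝ) : EReal))
        (𝓝[<] (1 : ℝ)) (𝓝 (dUp : EReal)) ∧
      KreinFeller.upperMinkowskiDim ν.support = (dStar : EReal) ∧
      KreinFeller.lowerSpectralDim ν = (sLow : EReal) ∧
      KreinFeller.upperSpectralDim ν = (sUp : EReal) ∧
      dLow / (1 + dUp) ≤ sLow ∧
      sLow ≤ sUp ∧
      sUp ≤ dStar / (1 + dStar) ∧
      dStar / (1 + dStar) ≤ 1 / 2 ∧
      (sUp = dStar / (1 + dStar) ↔ dUp = dStar) := by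
  open KreinFeller in
  obtain ⟨dUp, hUp, hUp0, hUple, hUplt⟩ := exists_left_derivative hν hsupp
  obtain ⟨dLow, hLow, hLowlt⟩ := exists_right_derivative hν hsupp
  set D := lqReal ν 0 with hD
  have hD0 : 0 ≤ D := lqReal_nonneg hν hsupp le_rfl zero_le_one
  have hD1 : D ≤ 1 := hasGrowth_zero_one.lqReal_le hν hsupp le_rfl
  have hp1 : D / (1 + D) < 1 := by rw [div_lt_one (by linarith)]; linarith
  have hp0 : 0 ≤ D / (1 + D) := by positivity
  -- To the right of its intersection with the diagonal the chord, and hence the spectrum, lies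
  -- below the diagonal.
  have hupper : ∀ q, D / (1 + D) < q → q < 1 → upperSpectralDim ν ≤ (q : EReal) := by
    intro q hq hq1
    have hq0 : 0 < q := hp0.trans_lt hq
    refine upperSpectralDim_le_of_lqReal_lt hν hsupp hq0
      ((lqReal_le_chord hν hsupp hq0.le hq1.le).trans_lt ?_)
    rw [div_lt_iff₀ (by linarith)] at hq
    linarith
  have hle : lowerSpectralDim ν ≤ upperSpectralDim ν := liminf_le_limsup
  have hlow0 := lowerSpectralDim_nonneg hν hsupp
  obtain ⟨q₀, hq₀, hq₁⟩ := exists_between hp1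
  have htop : upperSpectralDim ν ≠ ⊤ := ne_top_of_le_ne_top (EReal.coe_ne_top _) (hupper q₀ hq₀ hq₁)
  obtain ⟨sUp, hsUp⟩ : ∃ s : ℝ, upperSpectralDim ν = s :=
    ⟨_, (EReal.coe_toReal htop (ne_bot_of_le_ne_bot EReal.zero_ne_bot (hlow0.trans hle))).symm⟩
  obtain ⟨sLow, hsLow⟩ : ∃ s : ℝ, lowerSpectralDim ν = s :=
    ⟨_, (EReal.coe_toReal (ne_top_of_le_ne_top htop hle)
      (ne_bot_of_le_ne_bot EReal.zero_ne_bot hlow0)).symm⟩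
  rw [hsLow, hsUp, EReal.coe_le_coe_iff] at hle
  rw [hsLow] at hlow0
  have hlow0' : 0 ≤ sLow := EReal.coe_le_coe_iff.1 hlow0
  have hsup_le : sUp ≤ D / (1 + D) := by
    by_contra! hlt
    obtain ⟨q, hq, hq'⟩ := exists_between (lt_min hlt hp1)
    have := hupper q hq (hq'.trans_le (min_le_right _ _))
    rw [hsUp, EReal.coe_le_coe_iff] at this
    exact absurd (hq'.trans_le (min_le_left _ _)) (not_lt.2 this)
  refine ⟨dLow, dUp, D, sLow, sUp, tendsto_lqSpectrum_div hν hsupp hLow,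
    tendsto_lqSpectrum_div hν hsupp hUp, upperMinkowskiDim_support hν hsupp, hsLow, hsUp, ?_, hle,
    hsup_le, ?_, ?_, ?_⟩
  · rw [div_le_iff₀ (by linarith)]
    by_contra! hlt
    obtain ⟨b, hb1, hb2⟩ := exists_between hlt
    have hb0 : 0 ≤ b := (mul_nonneg hlow0' (by linarith)).trans hb1.le
    obtain ⟨a, ha1, ha2⟩ : ∃ a, dUp < a ∧ sLow * (1 + a) < b := by
      -- The constraint on `a` is obtained by dividing by `sLow`; if `sLow = 0` any `a` above `dUp`
      -- works.
      rcases eq_or_lt_of_le hlow0' with h | h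
      · exact ⟨dUp + 1, by linarith, by rw [← h] at hb1 ⊢; linarith⟩
      · rw [mul_comm, ← lt_div_iff₀ h] at hb1
        obtain ⟨a, h1, h2⟩ := exists_between hb1
        exact ⟨a - 1, by linarith, by rw [lt_div_iff₀ h] at h2; linarith⟩
    obtain ⟨t, ht0, ht1, ht⟩ := hUplt a ha1
    obtain ⟨t', ht'1, ht'⟩ := hLowlt b hb2
    obtain ⟨c, hc1, hc2⟩ := exists_between ht
    obtain ⟨c', hc'1, hc'2⟩ := exists_between ht'
    have hmain := div_le_lowerSpectralDim hν hsupp (a := a) (b := b) (by linarith) hb0 ht1 hc2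
      (hasGrowth_of_lqReal_lt hν hsupp ht0.le hc1) ht'1 hc'2
      (hasGrowth_of_lqReal_lt hν hsupp (by linarith) hc'1)
    rw [hsLow, EReal.coe_le_coe_iff, div_le_iff₀ (by linarith)] at hmain
    linarith
  · rw [div_le_div_iff₀ (by linarith) two_pos]
    linarith
  · intro heq
    have hUpD : dUp ≤ D := by simpa using hUple 0 le_rfl one_pos
    by_contra hne
    -- If `dUp < D`, the chord of slope `-D` is steeper than the left tangent at 1, so the graph is
    -- strictly below it somewhere.
    obtain ⟨t, ht0, ht1, ht⟩ := hUplt D (lt_of_le_of_ne hUpD hne)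
    have := upperSpectralDim_lt_of_lt_chord hν hsupp ht0 ht1 ht
    rw [hsUp, heq] at this
    exact lt_irrefl _ this
  · intro heq
    refine le_antisymm hsup_le ?_
    rw [div_le_iff₀ (by linarith)]
    by_contra! hlt
    have hs0 : 0 ≤ sUp := hlow0'.trans hle
    obtain ⟨s, hs1, hs2⟩ : ∃ s, sUp < s ∧ s * (1 + D) < D := by
      rw [← lt_div_iff₀ (by linarith)] at hlt
      obtain ⟨s, h1, h2⟩ := exists_between hlt
      exact ⟨s, h1, by rwa [lt_div_iff₀ (by linarith)] at h2⟩
    have hsD : s < D * (1 - s) := by linarith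
    have hs1' : s < 1 := by nlinarith
    obtain ⟨x₁, hx₁⟩ := exists_eigenvalueNum_le_rpow hν hsupp (s := s)
      (by rw [hsUp]; exact EReal.coe_lt_coe_iff.2 hs1)
    -- For `dUp = D` the supporting line at 1 is the chord itself, while polynomial growth of the
    -- count with exponent `s` bounds the spectrum by `s`.
    have hbound : ∀ q, s < q → q < 1 → D * (1 - q) ≤ s := by
      intro q hq hq1
      have h1 := (hasGrowth_of_eigenvalueNum_le hν hsupp (hs0.trans hs1.le) hq hx₁).lqReal_le hν
        hsupp (by linarith)
      have h2 := hUple q (by linarith) hq1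
      rw [heq] at h2
      linarith
    have hDpos : 0 < D := by nlinarith
    -- Since `s < D * (1 - s)`, some `q` slightly above `s` still satisfies `s < D * (1 - q)`,
    -- against `hbound`.
    have hlt' : s < min 1 (1 - s / D) := by
      refine lt_min hs1' ?_
      rw [lt_sub_iff_add_lt, ← lt_sub_iff_add_lt', div_lt_iff₀ hDpos]
      linarith
    obtain ⟨q, hq1, hq2⟩ := exists_between hlt'
    have h1 := hbound q hq1 (hq2.trans_le (min_le_left _ _))
    have h2 := hq2.trans_le (min_le_right _ _)
    rw [lt_sub_iff_add_lt, ← lt_sub_iff_add_lt', div_lt_iff₀ hDpos] at h2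
    linarith
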